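/- \textbf{Setting.} We work in guarded dependent type theory, interpreted in its standard model, the topos of trees. A closed type is a presheaf $X(1)\leftarrow X(2)\leftarrow X(3)\leftarrow\cdots$ of sets, a term is a natural family of functions, and a type depending on $x:X$ is a presheaf on the elements of $X$. A closed type is \emph{inhabited} if it has a global element, i.e. a family of elements at all stages that is compatible with restriction. The type $\triangleright X$ is given by $(\triangleright X)(1)=1$, $(\triangleright X)(n+1)=X(n)$; $\operatorname{next}\colon X\to\triangleright X$ is restriction and $\circledast\colon\triangleright(X\to Y)\to\triangleright X\to\triangleright Y$ is application. A relation $R$ from $A$ to $B$ is a (proof-relevant) type $x\,R\,y$ depending on $x:A$, $y:B$, and $\triangleright R$ is the induced relation from $\triangleright A$ to $\triangleright B$; at stage $1$ it is a one-point set, and at stage $n+1$ it is $R$ at stage $n$. The lifting monad is the solution $LA\cong A+\triangleright LA$, with structure maps $\eta\colon A\to LA$ and $\theta\colon\triangleright LA\to LA$; put $\delta=\theta\circ\operatorname{next}$, and let $\bot=\theta(\operatorname{next}\bot)$. \textbf{FPC.} Types are $\tau::=\alpha\mid 1\mid\tau+\tau\mid\tau\times\tau\mid\tau\to\tau\mid\mu\alpha.\tau$.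 Terms are those of the simply typed $\lambda$-calculus with unit, sums and products, together with $\mathsf{fold}$ and $\mathsf{unfold}$, with the usual typing rules $\Gamma\vdash M:\sigma$ ($\Gamma$ and $\sigma$ closed); in particular $\mathsf{fold}\,M:\mu\alpha.\tau$ if $M:\tau[\mu\alpha.\tau/\alpha]$, and $\mathsf{unfold}\,M:\tau[\mu\alpha.\tau/\alpha]$ if $M:\mu\alpha.\tau$. \textbf{Denotations.} Closed types are interpreted by $[\![1]\!]=L1$, $[\![\sigma+\tau]\!]=L([\![\sigma]\!]+[\![\tau]\!])$, $[\![\sigma\times\tau]\!]=[\![\sigma]\!]\times[\![\tau]\!]$, $[\![\sigma\to\tau]\!]=[\![\sigma]\!]\to[\![\tau]\!]$, $[\![\mu\alpha.\tau]\!]=\triangleright[\![\tau[\mu\alpha.\tau/\alpha]]\!]$. Each carries a map $\theta_\sigma\colon\triangleright[\![\sigma]\!]\to[\![\sigma]\!]$: it is the $\theta$ of $L$ for $1$ and sums, it is componentwise for products, $\theta_{\sigma\to\tau}(f)(x)=\theta_\tau(f\circledast\operatorname{next}x)$, and $\theta_{\mu\alpha.\tau}(x)=\operatorname{next}(\theta_{\tau[\mu\alpha.\tau/\alpha]})\circledast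 x$. A derivation of $\Gamma\vdash M:\sigma$ denotes a map $[\![M]\!]\colon[\![\Gamma]\!]\to[\![\sigma]\!]$, where $[\![\Gamma]\!]$ is the product of the interpretations of the types in $\Gamma$: variables, functions and products are interpreted as in type theory, $[\![\langle\rangle]\!](\gamma)=\eta(*)$, $[\![\mathsf{inl}\,M]\!](\gamma)=\eta(\mathrm{inl}\,[\![M]\!](\gamma))$ and similarly for $\mathsf{inr}$; $[\![\mathsf{case}\,L\,\mathsf{of}\,x_1.M;x_2.N]\!](\gamma)=h([\![L]\!](\gamma))$ where $h(\eta(\mathrm{inl}\,a))=[\![M]\!](\gamma,a)$, $h(\eta(\mathrm{inr}\,b))=[\![N]\!](\gamma,b)$ and $h(\theta(r))=\theta_\sigma(\operatorname{next}(h)\circledast r)$; finally $[\![\mathsf{fold}\,M]\!](\gamma)=\operatorname{next}([\![M]\!](\gamma))$ and $[\![\mathsf{unfold}\,M]\!](\gamma)=\theta_{\tau[\mu\alpha.\tau/\alpha]}([\![M]\!](\gamma))$. \textbf{The relation.} For a relation $R$ from $A$ to $B$ define $LR$ from $LA$ to $LB$ by guarded recursion: $\eta(x)\,LR\,\eta(y)$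 is $x\,R\,y$; $\eta(x)\,LR\,\theta(y)$ is $\Sigma_{n:\mathbb N,\,y'}\ (\theta(y)=\delta^n(\eta(y')))\times(x\,R\,y')$; $\theta(x)\,LR\,\eta(y)$ is $\Sigma_{n:\mathbb N,\,x'}\ (\theta(x)=\delta^n(\eta(x')))\times(x'\,R\,y)$; and $\theta(x)\,LR\,\theta(y)$ is $x\,(\triangleright LR)\,y$. For closed $\sigma$ the relation $\approx_\sigma$ on $[\![\sigma]\!]$ is defined by guarded recursion and induction on $\sigma$: \begin{itemize} \item $\approx_1$ is $L(=)$, and $\approx_{\sigma+\tau}$ is $L({\approx_\sigma}+{\approx_\tau})$, where $R+R'$ relates $\mathrm{inl}\,x$ to $\mathrm{inl}\,y$ by $x\,R\,y$, relates $\mathrm{inr}\,x$ to $\mathrm{inr}\,y$ by $x\,R'\,y$, and is empty otherwise; \item $x\approx_{\sigma\times\tau}y$ is $(\pi_1x\approx_\sigma\pi_1y)\times(\pi_2x\approx_\tau\pi_2y)$; \item $f\approx_{\sigma\to\tau}g$ is $\Pi_{x,y:[\![\sigma]\!]}\ (x\approx_\sigma y)\to (f(x)\approx_\tau g(y))$;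 \item $x\approx_{\mu\alpha.\tau}y$ is $x\,(\triangleright{\approx_{\tau[\mu\alpha.\tau/\alpha]}})\,y$. \end{itemize} For $f,g\colon[\![\Gamma]\!]\to[\![\sigma]\!]$, the type $f\approx_{\Gamma,\sigma}g$ is $\Pi_{\vec x,\vec y:[\![\Gamma]\!]}\ (\vec x\approx_\Gamma\vec y)\to (f(\vec x)\approx_\sigma g(\vec y))$, where $\approx_\Gamma$ is componentwise. \textbf{Proposition.} If $\Gamma\vdash M:\sigma$, then $[\![M]\!]\approx_{\Gamma,\sigma}[\![M]\!]$ is inhabited. The relation itself is not reflexive: for the function $f\colon L1\to L1$ with $f(\eta(*))=\eta(*)$ and $f(\theta(x))=\bot$, the type $f\approx_{1\to1}f$ is not inhabited. -/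

import Mathlib

/-! ## Syntax of FPC -/

namespace FPC

/-- FPC types `Θ ⊢ τ` with `k = |Θ|` type variables, in de Bruijn style (`var 0` is the innermost
variable, bound by the nearest `mu`). Closed types are the elements of `Ty 0`. -/
inductive Ty : ℕ → Type
  | var {k : ℕ} (i : Fin k) : Ty k
  | one {k : ℕ} : Ty k
  | sum {k : ℕ} (σ τ : Ty k) : Ty k
  | prod {k : ℕ} (σ τ : Ty k) : Ty k
  | arrow {k : ℕ} (σ τ : Ty k) : Ty k
  | mu {k : ℕ} (τ : Ty (k + 1)) : Ty k

def Ty.rename : {k l : ℕ} → (Fin k → Fin l) → Ty k → Ty l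
  | _, _, f, .var i => .var (f i)
  | _, _, _, .one => .one
  | _, _, f, .sum σ τ => .sum (σ.rename f) (τ.rename f)
  | _, _, f, .prod σ τ => .prod (σ.rename f) (τ.rename f)
  | _, _, f, .arrow σ τ => .arrow (σ.rename f) (τ.rename f)
  | _, _, f, .mu τ => .mu (τ.rename (Fin.cases 0 fun i => (f i).succ))

/-- Simultaneous capture-avoiding substitution. -/
def Ty.subst : {k l : ℕ} → (Fin k → Ty l) → Ty k → Ty l
  | _, _, s, .var i => s i
  | _, _, _, .one => .one
  | _, _, s, .sum σ τ => .sum (σ.subst s) (τ.subst s)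
  | _, _, s, .prod σ τ => .prod (σ.subst s) (τ.subst s)
  | _, _, s, .arrow σ τ => .arrow (σ.subst s) (τ.subst s)
  | _, _, s, .mu τ => .mu (τ.subst (Fin.cases (.var 0) fun i => (s i).rename Fin.succ))

/-- The unfolding `τ[μα.τ/α]` of `μα.τ`. -/
def Ty.unfold (τ : Ty 1) : Ty 0 := τ.subst fun _ => .mu τ

/-- Structural recursion on closed types, in which recursive types are a base case. -/
def Ty.closedRec {M : Ty 0 → Type*} (one : M .one)
    (sum : ∀ σ τ, M σ → M τ → M (.sum σ τ)) (prod : ∀ σ τ, M σ → M τ → M (.prod σ τ))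
    (arrow : ∀ σ τ, M σ → M τ → M (.arrow σ τ)) (mu : ∀ τ, M (.mu τ)) (σ : Ty 0) : M σ :=
  go σ
where
  /-- the same recursion, with the trivial motive on types that have free variables -/
  go : {k : ℕ} → (σ : Ty k) → (match k, σ with | 0, σ => M σ | _ + 1, _ => PUnit)
    | 0, .var i => i.elim0
    | 0, .one => one
    | 0, .sum σ τ => sum σ τ (go σ) (go τ)
    | 0, .prod σ τ => prod σ τ (go σ) (go τ)
    | 0, .arrow σ τ => arrow σ τ (go σ) (go τ)
    | 0, .mu τ => mu τ
    | _ + 1, _ => ⟨⟩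

/-- Raw FPC terms, in de Bruijn style: `lam` binds one variable, and `case L M N` binds one
variable in `M` and one in `N`. -/
inductive Term : Type
  | star : Term
  | var (i : ℕ) : Term
  | inl (M : Term) : Term
  | inr (M : Term) : Term
  | case (L M N : Term) : Term
  | pair (M N : Term) : Term
  | fst (M : Term) : Term
  | snd (M : Term) : Term
  | lam (σ : Ty 0) (M : Term) : Term
  | app (M N : Term) : Term
  | fold (M : Term) : Term
  | unfold (M : Term) : Term

/-- Contexts of closed types; the head is the most recently bound variable. -/
abbrev Ctx : Type := List (Ty 0)

/-- `Lookup Γ i σ`: the `i`-th variable of `Γ` has type `σ`. -/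
inductive Lookup : Ctx → ℕ → Ty 0 → Type
  | zero {Γ : Ctx} {σ : Ty 0} : Lookup (σ :: Γ) 0 σ
  | succ {Γ : Ctx} {i : ℕ} {σ τ : Ty 0} (h : Lookup Γ i σ) : Lookup (τ :: Γ) (i + 1) σ

/-- Derivations of the typing judgement `Γ ⊢ M : σ`. -/
inductive Typing : Ctx → Term → Ty 0 → Type
  | var {Γ : Ctx} {i : ℕ} {σ : Ty 0} (h : Lookup Γ i σ) : Typing Γ (.var i) σ
  | star {Γ : Ctx} : Typing Γ .star .one
  | lam {Γ : Ctx} {M : Term} {σ τ : Ty 0} (d : Typing (σ :: Γ) M τ) :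
      Typing Γ (.lam σ M) (.arrow σ τ)
  | app {Γ : Ctx} {M N : Term} {σ τ : Ty 0} (d : Typing Γ M (.arrow σ τ)) (e : Typing Γ N σ) :
      Typing Γ (.app M N) τ
  | inl {Γ : Ctx} {M : Term} {σ τ : Ty 0} (d : Typing Γ M σ) : Typing Γ (.inl M) (.sum σ τ)
  | inr {Γ : Ctx} {M : Term} {σ τ : Ty 0} (d : Typing Γ M τ) : Typing Γ (.inr M) (.sum σ τ)
  | case {Γ : Ctx} {L M N : Term} {τ₁ τ₂ σ : Ty 0} (d : Typing Γ L (.sum τ₁ τ₂))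
      (e₁ : Typing (τ₁ :: Γ) M σ) (e₂ : Typing (τ₂ :: Γ) N σ) : Typing Γ (.case L M N) σ
  | fst {Γ : Ctx} {M : Term} {σ τ : Ty 0} (d : Typing Γ M (.prod σ τ)) : Typing Γ (.fst M) σ
  | snd {Γ : Ctx} {M : Term} {σ τ : Ty 0} (d : Typing Γ M (.prod σ τ)) : Typing Γ (.snd M) τ
  | pair {Γ : Ctx} {M N : Term} {σ τ : Ty 0} (d : Typing Γ M σ) (e : Typing Γ N τ) :
      Typing Γ (.pair M N) (.prod σ τ)
  | unfold {Γ : Ctx} {M : Term} {τ : Ty 1} (d : Typing Γ M (.mu τ)) :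
      Typing Γ (.unfold M) τ.unfold
  | fold {Γ : Ctx} {M : Term} {τ : Ty 1} (d : Typing Γ M τ.unfold) :
      Typing Γ (.fold M) (.mu τ)

/-!
## Interpretation of closed types

Guarded dependent type theory is read in its standard model, the topos of trees: a type is a
presheaf `X 1 ← X 2 ← X 3 ← ⋯`, a term is a natural family of maps, a type depending on `x : X` is
a presheaf on the elements of `X`, and `▷` is `(▷X) 1 = 1`, `(▷X) (n + 1) = X n`. We put `X 0 = 1`
throughout, so that `(▷X) (n + 1) = X n` holds for all `n`; stage `0` carries no information.
Guarded recursion is recursion on the stage: everything at stage `n + 1` is defined from everything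
at stage `n`, and then by structural recursion on closed types.
-/

/-- `P` is the set of elements of a presheaf at stage `n`; an `Ext P` is its set of elements at
stage `n + 1`, with the restriction map. -/
structure Ext (P : Type) : Type 1 where
  pt : Type
  res : pt → P

/-- `A × B` at stage `n + 1`; `pair` is the pairing at stage `n`. -/
def Ext.prod {P Q PQ : Type} (E : Ext P) (F : Ext Q) (pair : P → Q → PQ) : Ext PQ :=
  ⟨E.pt × F.pt, fun x => pair (E.res x.1) (F.res x.2)⟩

/-- `A + B` at stage `n + 1`. -/
def Ext.sum {P Q : Type} (E : Ext P) (F : Ext Q) : Ext (P ⊕ Q) :=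
  ⟨E.pt ⊕ F.pt, Sum.map E.res F.res⟩

/-- The exponential `A → B` at stage `n + 1`: its elements are the natural families of maps
`A m → B m` for `m ≤ n + 1`, that is, an element of `A → B` at stage `n` with a compatible map at
stage `n + 1`. Here `app` is the evaluation at stage `n`. -/
def Ext.arrow {P Q PQ : Type} (E : Ext P) (F : Ext Q) (app : PQ → P → Q) : Ext PQ :=
  ⟨{f : PQ × (E.pt → F.pt) // ∀ x, F.res (f.2 x) = app f.1 (E.res x)}, fun f => f.1.1⟩

/-- The lifting `L A ≅ A + ▷ L A` at stage `n + 1`, where `LP` is the set of elements of `L A` at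
stage `n`, with `ret = η : A → L A` and `delay = θ ∘ next : L A → L A` at stage `n`. The elements
are `η a` (written `inl a`) and `θ x` (written `inr x`). -/
def Ext.lift {P LP : Type} (E : Ext P) (ret : P → LP) (delay : LP → LP) : Ext LP :=
  ⟨E.pt ⊕ LP, Sum.elim (fun a => ret (E.res a)) delay⟩

/-- The delay `δ = θ ∘ next` of `L A` at stage `n + 1`. -/
def Ext.liftDelay {P LP : Type} (E : Ext P) (ret : P → LP) (delay : LP → LP)
    (x : (E.lift ret delay).pt) : (E.lift ret delay).pt :=
  .inr ((E.lift ret delay).res x)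

/-- The universe of presheaves with its decoding, by recursion on the stage: an element of
`(univ n).1` is a presheaf `X 0 ← X 1 ← ⋯ ← X n` with `X 0 = 1`, and `(univ n).2` maps it to
`X n`. -/
def univ : ℕ → (U : Type 1) × (U → Type)
  | 0 => ⟨PUnit, fun _ => PUnit⟩
  | n + 1 => ⟨(X : (univ n).1) × Ext ((univ n).2 X), fun X => X.2.pt⟩

abbrev Univ (n : ℕ) : Type 1 := (univ n).1

abbrev top {n : ℕ} (X : Univ n) : Type := (univ n).2 X

/-- The interpretations of all closed types up to stage `n`, with the operations at stage `n`. -/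
structure Stage (n : ℕ) : Type 1 where
  /-- `⟦σ⟧` up to stage `n` -/
  ty : Ty 0 → Univ n
  /-- `η : 1 → L 1 = ⟦1⟧` -/
  retOne : Unit → top (ty .one)
  /-- `η : ⟦σ⟧ + ⟦τ⟧ → L (⟦σ⟧ + ⟦τ⟧) = ⟦σ + τ⟧` -/
  ret {σ τ : Ty 0} : top (ty σ) ⊕ top (ty τ) → top (ty (.sum σ τ))
  pair {σ τ : Ty 0} : top (ty σ) → top (ty τ) → top (ty (.prod σ τ))
  fst {σ τ : Ty 0} : top (ty (.prod σ τ)) → top (ty σ)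
  snd {σ τ : Ty 0} : top (ty (.prod σ τ)) → top (ty τ)
  app {σ τ : Ty 0} : top (ty (.arrow σ τ)) → top (ty σ) → top (ty τ)
  /-- `next : ⟦τ[μα.τ/α]⟧ → ▷⟦τ[μα.τ/α]⟧ = ⟦μα.τ⟧` -/
  next {τ : Ty 1} : top (ty τ.unfold) → top (ty (.mu τ))
  /-- `θ : ⟦μα.τ⟧ = ▷⟦τ[μα.τ/α]⟧ → ⟦τ[μα.τ/α]⟧` -/
  unfold {τ : Ty 1} : top (ty (.mu τ)) → top (ty τ.unfold)
  /-- `δ = θ ∘ next : ⟦σ⟧ → ⟦σ⟧` -/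
  delay {σ : Ty 0} : top (ty σ) → top (ty σ)
  fst_pair {σ τ : Ty 0} (x : top (ty σ)) (y : top (ty τ)) : fst (pair x y) = x
  snd_pair {σ τ : Ty 0} (x : top (ty σ)) (y : top (ty τ)) : snd (pair x y) = y
  pair_delay {σ τ : Ty 0} (x : top (ty (.prod σ τ))) :
    pair (delay (fst x)) (delay (snd x)) = delay x
  app_delay {σ τ : Ty 0} (f : top (ty (.arrow σ τ))) (x : top (ty σ)) :
    app (delay f) x = delay (app f x)
  unfold_next {τ : Ty 1} (x : top (ty τ.unfold)) : unfold (next x) = delay x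
  next_unfold {τ : Ty 1} (x : top (ty (.mu τ))) : next (unfold x) = delay x

/-- `⟦σ⟧` at stage `n`. -/
abbrev Stage.El {n : ℕ} (S : Stage n) (σ : Ty 0) : Type := top (S.ty σ)

/-- Stage `0`, at which every type is a one-point set. -/
def Stage.zero : Stage 0 where
  ty _ := ⟨⟩
  retOne _ := ⟨⟩
  ret _ := ⟨⟩
  pair _ _ := ⟨⟩
  fst _ := ⟨⟩
  snd _ := ⟨⟩
  app _ _ := ⟨⟩
  next _ := ⟨⟩
  unfold _ := ⟨⟩
  delay _ := ⟨⟩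
  fst_pair _ _ := rfl
  snd_pair _ _ := rfl
  pair_delay _ := rfl
  app_delay _ _ := rfl
  unfold_next _ := rfl
  next_unfold _ := rfl

/-- `⟦σ⟧` at stage `n + 1` and the restriction to stage `n`:
`⟦1⟧ = L 1`, `⟦σ + τ⟧ = L (⟦σ⟧ + ⟦τ⟧)`, `⟦σ × τ⟧ = ⟦σ⟧ × ⟦τ⟧`, `⟦σ → τ⟧ = ⟦σ⟧ → ⟦τ⟧` and
`⟦μα.τ⟧ = ▷ ⟦τ[μα.τ/α]⟧`. -/
def Stage.ext {n : ℕ} (S : Stage n) (σ : Ty 0) : Ext (S.El σ) :=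
  Ty.closedRec (M := fun σ => Ext (S.El σ))
    (one := (Ext.mk Unit id).lift S.retOne S.delay)
    (sum := fun _ _ E F => (E.sum F).lift S.ret S.delay)
    (prod := fun _ _ E F => E.prod F S.pair)
    (arrow := fun _ _ E F => E.arrow F S.app)
    (mu := fun τ => ⟨S.El τ.unfold, S.next⟩) σ

/-- The `▷`-algebra structure `θ : ▷⟦σ⟧ → ⟦σ⟧` at stage `n + 1`, where `(▷⟦σ⟧) (n + 1)` is
`⟦σ⟧` at stage `n`, together with its naturality: restricted to stage `n` it is `θ ∘ next`. -/
def Stage.theta {n : ℕ} (S : Stage n) (σ : Ty 0) :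
    {t : S.El σ → (S.ext σ).pt // ∀ x, (S.ext σ).res (t x) = S.delay x} :=
  Ty.closedRec (M := fun σ => {t : S.El σ → (S.ext σ).pt // ∀ x, (S.ext σ).res (t x) = S.delay x})
    (one := ⟨fun x => .inr x, fun _ => rfl⟩)
    (sum := fun _ _ _ _ => ⟨fun x => .inr x, fun _ => rfl⟩)
    (prod := fun _ _ s t => ⟨fun x => (s.1 (S.fst x), t.1 (S.snd x)), fun x =>
      (congrArg₂ S.pair (s.2 _) (t.2 _)).trans (S.pair_delay x)⟩)
    (arrow := fun σ _ _ t =>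
      ⟨fun f => ⟨(S.delay f, fun x => t.1 (S.app f ((S.ext σ).res x))), fun _ =>
        (t.2 _).trans (S.app_delay _ _).symm⟩, fun _ => rfl⟩)
    (mu := fun _ => ⟨S.unfold, S.next_unfold⟩) σ

/-- Stage `n + 1`, from stage `n`. -/
def Stage.succ {n : ℕ} (S : Stage n) : Stage (n + 1) where
  ty σ := ⟨S.ty σ, S.ext σ⟩
  retOne a := Sum.inl a
  ret a := Sum.inl a
  pair x y := (x, y)
  fst x := x.1
  snd x := x.2
  app f x := f.1.2 x
  next {τ} x := (S.ext τ.unfold).res x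
  unfold {τ} x := (S.theta τ.unfold).1 x
  delay {σ} x := (S.theta σ).1 ((S.ext σ).res x)
  fst_pair _ _ := rfl
  snd_pair _ _ := rfl
  pair_delay {σ τ} x := congrArg₂ Prod.mk
    (congrArg (S.theta σ).1 (S.fst_pair ((S.ext σ).res x.1) ((S.ext τ).res x.2)).symm)
    (congrArg (S.theta τ).1 (S.snd_pair ((S.ext σ).res x.1) ((S.ext τ).res x.2)).symm)
  app_delay {_ τ} f x := congrArg (S.theta τ).1 (f.2 x).symm
  unfold_next _ := rfl
  next_unfold {τ} x := ((S.theta τ.unfold).2 x).trans (S.unfold_next x).symm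

def stage : (n : ℕ) → Stage n
  | 0 => Stage.zero
  | n + 1 => (stage n).succ

/-- The presheaf `⟦σ⟧`: its set of elements at stage `n`. -/
abbrev El (n : ℕ) (σ : Ty 0) : Type := (stage n).El σ

/-- The restriction maps of the presheaf `⟦σ⟧`. -/
def res {n : ℕ} {σ : Ty 0} (x : El (n + 1) σ) : El n σ := ((stage n).ext σ).res x

/-- `θ : ▷⟦σ⟧ → ⟦σ⟧` at stage `n + 1`. -/
def theta {n : ℕ} {σ : Ty 0} (x : El n σ) : El (n + 1) σ := ((stage n).theta σ).1 x

theorem res_theta {n : ℕ} {σ : Ty 0} (x : El n σ) : res (theta x) = (stage n).delay x :=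
  ((stage n).theta σ).2 x

/-! ## Interpretation of open types -/

namespace Univ

/-- The presheaf `1`, with its element. -/
def unit : (n : ℕ) → (Z : Univ n) × (Unit → top Z)
  | 0 => ⟨⟨⟩, fun _ => ⟨⟩⟩
  | n + 1 => ⟨⟨(unit n).1, ⟨Unit, (unit n).2⟩⟩, id⟩

/-- The presheaf `X × Y`, with pairing. -/
def prod : {n : ℕ} → (X Y : Univ n) → (Z : Univ n) × (top X → top Y → top Z)
  | 0, _, _ => ⟨⟨⟩, fun _ _ => ⟨⟩⟩
  | _ + 1, ⟨X, E⟩, ⟨Y, F⟩ => ⟨⟨(prod X Y).1, E.prod F (prod X Y).2⟩, Prod.mk⟩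

/-- The presheaf `X + Y`, with the injections. -/
def sum : {n : ℕ} → (X Y : Univ n) → (Z : Univ n) × (top X ⊕ top Y → top Z)
  | 0, _, _ => ⟨⟨⟩, fun _ => ⟨⟩⟩
  | _ + 1, ⟨X, E⟩, ⟨Y, F⟩ =>
    ⟨⟨(sum X Y).1, ⟨E.pt ⊕ F.pt, fun x => (sum X Y).2 ((E.sum F).res x)⟩⟩, id⟩

/-- The presheaf `X → Y`, with evaluation. -/
def arrow : {n : ℕ} → (X Y : Univ n) → (Z : Univ n) × (top Z → top X → top Y)
  | 0, _, _ => ⟨⟨⟩, fun _ _ => ⟨⟩⟩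
  | _ + 1, ⟨X, E⟩, ⟨Y, F⟩ =>
    ⟨⟨(arrow X Y).1, E.arrow F (arrow X Y).2⟩, fun f x => f.1.2 x⟩

/-- The presheaf `L X`, with `η` and `δ`. -/
def lift : {n : ℕ} → (X : Univ n) → (Z : Univ n) × (top X → top Z) × (top Z → top Z)
  | 0, _ => ⟨⟨⟩, fun _ => ⟨⟩, fun _ => ⟨⟩⟩
  | _ + 1, ⟨X, E⟩ =>
    ⟨⟨(lift X).1, E.lift (lift X).2.1 (lift X).2.2⟩, Sum.inl,
      E.liftDelay (lift X).2.1 (lift X).2.2⟩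

/-- The presheaf `▷X` up to stage `n`, with `next`. -/
def next : {n : ℕ} → (X : Univ n) → (Z : Univ n) × (top X → top Z)
  | 0, _ => ⟨⟨⟩, fun _ => ⟨⟩⟩
  | _ + 1, ⟨X, E⟩ => ⟨⟨(next X).1, ⟨top X, (next X).2⟩⟩, E.res⟩

/-- The code `▷ : ▷U → U` at stage `n + 1`: the presheaf `▷X` up to stage `n + 1`. -/
def later {n : ℕ} (X : Univ n) : Univ (n + 1) := ⟨(next X).1, ⟨top X, (next X).2⟩⟩

end Univ

/-- The interpretation `⟦Θ ⊢ τ⟧ : U^|Θ| → U`, by structural recursion on `τ`, where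
`⟦Θ ⊢ μα.τ⟧` is the guarded fixed point of `ρ ↦ ▷ ⟦Θ, α ⊢ τ⟧ (ρ, ⟦Θ ⊢ μα.τ⟧ ρ)`. -/
def Ty.interp : {k : ℕ} → Ty k → (n : ℕ) → (Fin k → Univ n) → Univ n
  | _, .var i, _, ρ => ρ i
  | _, .one, n, _ => (Univ.lift (Univ.unit n).1).1
  | _, .sum σ τ, n, ρ => (Univ.lift (Univ.sum (σ.interp n ρ) (τ.interp n ρ)).1).1
  | _, .prod σ τ, n, ρ => (Univ.prod (σ.interp n ρ) (τ.interp n ρ)).1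
  | _, .arrow σ τ, n, ρ => (Univ.arrow (σ.interp n ρ) (τ.interp n ρ)).1
  | k, .mu τ, n, ρ =>
    Nat.rec (motive := fun n => (Fin k → Univ n) → Univ n) (fun _ => ⟨⟩)
      (fun n X ρ =>
        .later (τ.interp n (Fin.cases (X fun i => (ρ i).1) fun i => (ρ i).1))) n ρ

theorem Ty.rename_rename {k l m : ℕ} (f : Fin k → Fin l) (g : Fin l → Fin m) (τ : Ty k) :
    (τ.rename f).rename g = τ.rename (g ∘ f) := by
  induction τ generalizing l m with
  | var i => rfl
  | one => rfl
  | sum _ _ h h' => simp only [rename, h, h']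
  | prod _ _ h h' => simp only [rename, h, h']
  | arrow _ _ h h' => simp only [rename, h, h']
  | mu _ h =>
    simp only [rename, h]
    congr 2
    funext i
    cases i using Fin.cases <;> rfl

theorem Ty.subst_rename {k l m : ℕ} (f : Fin k → Fin l) (s : Fin l → Ty m) (τ : Ty k) :
    (τ.rename f).subst s = τ.subst (s ∘ f) := by
  induction τ generalizing l m with
  | var i => rfl
  | one => rfl
  | sum _ _ h h' => simp only [rename, subst, h, h']
  | prod _ _ h h' => simp only [rename, subst, h, h']
  | arrow _ _ h h' => simp only [rename, subst, h, h']
  | mu _ h =>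
    simp only [rename, subst, h]
    congr 2
    funext i
    cases i using Fin.cases <;> rfl

theorem Ty.rename_subst {k l m : ℕ} (s : Fin k → Ty l) (f : Fin l → Fin m) (τ : Ty k) :
    (τ.subst s).rename f = τ.subst fun i => (s i).rename f := by
  induction τ generalizing l m with
  | var i => rfl
  | one => rfl
  | sum _ _ h h' => simp only [rename, subst, h, h']
  | prod _ _ h h' => simp only [rename, subst, h, h']
  | arrow _ _ h h' => simp only [rename, subst, h, h']
  | mu _ h =>
    simp only [rename, subst, h]
    congr 2
    funext i
    cases i using Fin.cases with
    | zero => rfl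
    | succ i => simp only [Fin.cases_succ, rename_rename]; rfl

theorem Ty.subst_subst {k l m : ℕ} (s : Fin k → Ty l) (t : Fin l → Ty m) (τ : Ty k) :
    (τ.subst s).subst t = τ.subst fun i => (s i).subst t := by
  induction τ generalizing l m with
  | var i => rfl
  | one => rfl
  | sum _ _ h h' => simp only [subst, h, h']
  | prod _ _ h h' => simp only [subst, h, h']
  | arrow _ _ h h' => simp only [subst, h, h']
  | mu _ h =>
    simp only [subst, h]
    congr 2
    funext i
    cases i using Fin.cases with
    | zero => rfl
    | succ i => simp only [Fin.cases_succ, subst_rename, rename_subst]; rfl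

theorem Ty.subst_var {k : ℕ} (τ : Ty k) : τ.subst .var = τ := by
  induction τ with
  | var i => rfl
  | one => rfl
  | sum _ _ h h' => simp only [subst, h, h']
  | prod _ _ h h' => simp only [subst, h, h']
  | arrow _ _ h h' => simp only [subst, h, h']
  | mu _ h =>
    simp only [subst]
    congr 1
    conv_rhs => rw [← h]
    congr 1
    funext i
    cases i using Fin.cases <;> rfl

/-- `(τ[s↑])[μα.τ[s↑]/α] = τ[s, μα.τ[s↑]]` -/
theorem Ty.unfold_subst {k : ℕ} (s : Fin k → Ty 0) (τ : Ty (k + 1)) :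
    (τ.subst (Fin.cases (.var 0) fun i => (s i).rename Fin.succ)).unfold =
      τ.subst (Fin.cases (Ty.subst s (.mu τ)) s) := by
  rw [unfold, subst_subst]
  congr 1
  funext i
  cases i using Fin.cases with
  | zero => rfl
  | succ i =>
    simp only [Fin.cases_succ, subst_rename]
    conv_rhs => rw [← (s i).subst_var]
    congr 1
    funext j
    exact j.elim0

theorem lift_unit_eq : (n : ℕ) →
    (⟨(Univ.lift (Univ.unit n).1).1, fun a => (Univ.lift (Univ.unit n).1).2.1 ((Univ.unit n).2 a),
      (Univ.lift (Univ.unit n).1).2.2⟩ : (Z : Univ n) × (Unit → top Z) × (top Z → top Z)) =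
      ⟨(stage n).ty .one, (stage n).retOne, (stage n).delay⟩
  | 0 => rfl
  | n + 1 =>
    congrArg (fun Z : (Z : Univ n) × (Unit → top Z) × (top Z → top Z) =>
      (⟨⟨Z.1, (Ext.mk Unit id).lift Z.2.1 Z.2.2⟩, Sum.inl,
        (Ext.mk Unit id).liftDelay Z.2.1 Z.2.2⟩ :
        (Z : Univ (n + 1)) × (Unit → top Z) × (top Z → top Z))) (lift_unit_eq n)

theorem lift_sum_eq (σ τ : Ty 0) : (n : ℕ) →
    (⟨(Univ.lift (Univ.sum ((stage n).ty σ) ((stage n).ty τ)).1).1,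
      fun a => (Univ.lift (Univ.sum ((stage n).ty σ) ((stage n).ty τ)).1).2.1
        ((Univ.sum ((stage n).ty σ) ((stage n).ty τ)).2 a),
      (Univ.lift (Univ.sum ((stage n).ty σ) ((stage n).ty τ)).1).2.2⟩ :
        (Z : Univ n) × (El n σ ⊕ El n τ → top Z) × (top Z → top Z)) =
      ⟨(stage n).ty (.sum σ τ), (stage n).ret, (stage n).delay⟩
  | 0 => rfl
  | n + 1 =>
    congrArg (fun Z : (Z : Univ n) × (El n σ ⊕ El n τ → top Z) × (top Z → top Z) =>
      (⟨⟨Z.1, (((stage n).ext σ).sum ((stage n).ext τ)).lift Z.2.1 Z.2.2⟩, Sum.inl,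
        (((stage n).ext σ).sum ((stage n).ext τ)).liftDelay Z.2.1 Z.2.2⟩ :
        (Z : Univ (n + 1)) × (El (n + 1) σ ⊕ El (n + 1) τ → top Z) × (top Z → top Z)))
      (lift_sum_eq σ τ n)

theorem prod_eq (σ τ : Ty 0) : (n : ℕ) →
    Univ.prod ((stage n).ty σ) ((stage n).ty τ) = ⟨(stage n).ty (.prod σ τ), (stage n).pair⟩
  | 0 => rfl
  | n + 1 =>
    congrArg (fun Z : (Z : Univ n) × (El n σ → El n τ → top Z) =>
      (⟨⟨Z.1, ((stage n).ext σ).prod ((stage n).ext τ) Z.2⟩, Prod.mk⟩ :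
        (Z : Univ (n + 1)) × (El (n + 1) σ → El (n + 1) τ → top Z))) (prod_eq σ τ n)

theorem arrow_eq (σ τ : Ty 0) : (n : ℕ) →
    Univ.arrow ((stage n).ty σ) ((stage n).ty τ) = ⟨(stage n).ty (.arrow σ τ), (stage n).app⟩
  | 0 => rfl
  | n + 1 =>
    congrArg (fun Z : (Z : Univ n) × (top Z → El n σ → El n τ) =>
      (⟨⟨Z.1, ((stage n).ext σ).arrow ((stage n).ext τ) Z.2⟩, fun f x => f.1.2 x⟩ :
        (Z : Univ (n + 1)) × (top Z → El (n + 1) σ → El (n + 1) τ))) (arrow_eq σ τ n)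

theorem next_eq (τ : Ty 1) : (n : ℕ) →
    Univ.next ((stage n).ty τ.unfold) = ⟨(stage n).ty (.mu τ), (stage n).next⟩
  | 0 => rfl
  | n + 1 =>
    congrArg (fun Z : (Z : Univ n) × (El n τ.unfold → top Z) =>
      (⟨⟨Z.1, ⟨El n τ.unfold, Z.2⟩⟩, res⟩ :
        (Z : Univ (n + 1)) × (El (n + 1) τ.unfold → top Z))) (next_eq τ n)

theorem later_eq (τ : Ty 1) (n : ℕ) :
    Univ.later ((stage n).ty τ.unfold) = (stage (n + 1)).ty (.mu τ) :=
  congrArg (fun Z : (Z : Univ n) × (El n τ.unfold → top Z) =>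
    (⟨Z.1, ⟨El n τ.unfold, Z.2⟩⟩ : Univ (n + 1))) (next_eq τ n)

theorem Ty.interp_subst {k : ℕ} (τ : Ty k) : ∀ (n : ℕ) (s : Fin k → Ty 0),
    τ.interp n (fun i => (stage n).ty (s i)) = (stage n).ty (τ.subst s) := by
  induction τ with
  | var i => exact fun _ _ => rfl
  | one => exact fun n _ => congrArg Sigma.fst (lift_unit_eq n)
  | sum σ τ h h' =>
    intro n s
    rw [interp, h, h']
    exact congrArg Sigma.fst (lift_sum_eq _ _ n)
  | prod σ τ h h' =>
    intro n s
    rw [interp, h, h']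
    exact congrArg Sigma.fst (prod_eq _ _ n)
  | arrow σ τ h h' =>
    intro n s
    rw [interp, h, h']
    exact congrArg Sigma.fst (arrow_eq _ _ n)
  | mu τ h =>
    intro n s
    induction n with
    | zero => rfl
    | succ n ih =>
      refine Eq.trans ?_ (later_eq _ n)
      rw [unfold_subst, ← h]
      refine congrArg (fun ρ => Univ.later (τ.interp n ρ)) (funext fun i => ?_)
      cases i using Fin.cases with
      | zero => exact ih
      | succ i => rfl

/-- On closed types, the interpretation above is the one by `Ty.interp`. -/
theorem stage_ty (n : ℕ) (σ : Ty 0) : (stage n).ty σ = σ.interp n Fin.elim0 := by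
  conv_lhs => rw [← σ.subst_var, ← σ.interp_subst]
  congr 1
  funext i
  exact i.elim0

/-! ## Interpretation of terms -/

/-- `⟦Γ⟧` at stage `n`. -/
def Env (n : ℕ) : Ctx → Type
  | [] => Unit
  | σ :: Γ => El n σ × Env n Γ

def Env.res {n : ℕ} : {Γ : Ctx} → Env (n + 1) Γ → Env n Γ
  | [], _ => ()
  | _ :: _, γ => (FPC.res γ.1, Env.res γ.2)

/-- Morphisms `⟦Γ⟧ → ⟦σ⟧`. -/
structure Hom (Γ : Ctx) (σ : Ty 0) : Type where
  map (n : ℕ) : Env n Γ → El n σ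
  nat (n : ℕ) (γ : Env (n + 1) Γ) : res (map (n + 1) γ) = map n γ.res

namespace Hom

variable {Γ : Ctx} {σ τ υ : Ty 0}

def varMap (n : ℕ) : {Γ : Ctx} → {i : ℕ} → {σ : Ty 0} → Lookup Γ i σ → Env n Γ → El n σ
  | _, _, _, .zero, γ => γ.1
  | _, _, _, .succ h, γ => varMap n h γ.2

theorem varMap_nat (n : ℕ) : {Γ : Ctx} → {i : ℕ} → {σ : Ty 0} → (h : Lookup Γ i σ) →
    (γ : Env (n + 1) Γ) → res (varMap (n + 1) h γ) = varMap n h γ.res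
  | _, _, _, .zero, _ => rfl
  | _, _, _, .succ h, γ => varMap_nat n h γ.2

/-- `γ ↦ γ(x)` -/
def var {i : ℕ} (h : Lookup Γ i σ) : Hom Γ σ := ⟨fun n => varMap n h, fun n => varMap_nat n h⟩

/-- `γ ↦ η(*)` -/
def star : Hom Γ .one := ⟨fun n _ => (stage n).retOne (), fun _ _ => rfl⟩

/-- `γ ↦ η(inl (f γ))` -/
def inl (f : Hom Γ σ) : Hom Γ (.sum σ τ) :=
  ⟨fun n γ => (stage n).ret (.inl (f.map n γ)), fun n γ =>
    congrArg (fun x => (stage n).ret (.inl x)) (f.nat n γ)⟩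

/-- `γ ↦ η(inr (f γ))` -/
def inr (f : Hom Γ τ) : Hom Γ (.sum σ τ) :=
  ⟨fun n γ => (stage n).ret (.inr (f.map n γ)), fun n γ =>
    congrArg (fun x => (stage n).ret (.inr x)) (f.nat n γ)⟩

def pair (f : Hom Γ σ) (g : Hom Γ τ) : Hom Γ (.prod σ τ) :=
  ⟨fun n γ => (stage n).pair (f.map n γ) (g.map n γ), fun n γ =>
    congrArg₂ (stage n).pair (f.nat n γ) (g.nat n γ)⟩

def fst (f : Hom Γ (.prod σ τ)) : Hom Γ σ :=
  ⟨fun n γ => (stage n).fst (f.map n γ), fun n γ =>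
    ((stage n).fst_pair _ _).symm.trans (congrArg (stage n).fst (f.nat n γ))⟩

def snd (f : Hom Γ (.prod σ τ)) : Hom Γ τ :=
  ⟨fun n γ => (stage n).snd (f.map n γ), fun n γ =>
    ((stage n).snd_pair _ _).symm.trans (congrArg (stage n).snd (f.nat n γ))⟩

def app (f : Hom Γ (.arrow σ τ)) (g : Hom Γ σ) : Hom Γ τ :=
  ⟨fun n γ => (stage n).app (f.map n γ) (g.map n γ), fun n γ =>
    ((f.map (n + 1) γ).2 _).trans (congrArg₂ (stage n).app (f.nat n γ) (g.nat n γ))⟩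

/-- The element `λ x. f (γ, x)` of the exponential at stage `n`, with its values at stage `n`. -/
def lamMap (f : Hom (σ :: Γ) τ) :
    (n : ℕ) → {g : Env n Γ → El n (.arrow σ τ) // ∀ γ x, (stage n).app (g γ) x = f.map n (x, γ)}
  | 0 => ⟨fun _ => ⟨⟩, fun _ _ => rfl⟩
  | n + 1 => ⟨fun γ => ⟨((lamMap f n).1 γ.res, fun x => f.map (n + 1) (x, γ)), fun x =>
      (f.nat n (x, γ)).trans ((lamMap f n).2 γ.res (res x)).symm⟩, fun _ _ => rfl⟩

/-- `γ ↦ λ x. f (γ, x)` -/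
def lam (f : Hom (σ :: Γ) τ) : Hom Γ (.arrow σ τ) := ⟨fun n => (lamMap f n).1, fun _ _ => rfl⟩

/-- The unique extension of `[f(γ, -), g(γ, -)] : ⟦σ⟧ + ⟦τ⟧ → ⟦υ⟧` to a homomorphism of
`▷`-algebras `h : L (⟦σ⟧ + ⟦τ⟧) → ⟦υ⟧`: `h (η (inl a)) = f(γ, a)`, `h (η (inr b)) = g(γ, b)` and
`h (θ x) = θ (next h ⊛ x)`. -/
def copairMap (f : Hom (σ :: Γ) υ) (g : Hom (τ :: Γ) υ) :
    (n : ℕ) → Env n Γ → El n (.sum σ τ) → El n υ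
  | 0, _, _ => ⟨⟩
  | n + 1, γ, .inl (.inl a) => f.map (n + 1) (a, γ)
  | n + 1, γ, .inl (.inr b) => g.map (n + 1) (b, γ)
  | n + 1, γ, .inr x => theta (copairMap f g n γ.res x)

theorem copairMap_nat (f : Hom (σ :: Γ) υ) (g : Hom (τ :: Γ) υ) : (n : ℕ) →
    (γ : Env (n + 1) Γ) → (x : El (n + 1) (.sum σ τ)) →
    res (copairMap f g (n + 1) γ x) = copairMap f g n γ.res (res x)
  | 0, _, _ => rfl
  | n + 1, γ, .inl (.inl a) => f.nat (n + 1) (a, γ)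
  | n + 1, γ, .inl (.inr b) => g.nat (n + 1) (b, γ)
  | n + 1, γ, .inr x =>
    (res_theta _).trans (congrArg theta (copairMap_nat f g n γ.res x))

def case (l : Hom Γ (.sum σ τ)) (f : Hom (σ :: Γ) υ) (g : Hom (τ :: Γ) υ) : Hom Γ υ :=
  ⟨fun n γ => copairMap f g n γ (l.map n γ), fun n γ =>
    (copairMap_nat f g n γ _).trans (congrArg (copairMap f g n γ.res) (l.nat n γ))⟩

/-- `γ ↦ next (f γ)` -/
def fold {τ : Ty 1} (f : Hom Γ τ.unfold) : Hom Γ (.mu τ) :=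
  ⟨fun n γ => (stage n).next (f.map n γ), fun n γ => congrArg (stage n).next (f.nat n γ)⟩

/-- `γ ↦ θ (f γ)` -/
def unfold {τ : Ty 1} (f : Hom Γ (.mu τ)) : Hom Γ τ.unfold :=
  ⟨fun n γ => (stage n).unfold (f.map n γ), fun n γ =>
    ((stage n).theta τ.unfold).2 _ |>.trans <| ((stage n).unfold_next _).symm.trans
      (congrArg (stage n).unfold (f.nat n γ))⟩

end Hom

/-- The denotation `⟦Γ ⊢ M : σ⟧ : ⟦Γ⟧ → ⟦σ⟧`. -/
def Typing.den : {Γ : Ctx} → {M : Term} → {σ : Ty 0} → Typing Γ M σ → Hom Γ σ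
  | _, _, _, .var h => .var h
  | _, _, _, .star => .star
  | _, _, _, .lam d => .lam d.den
  | _, _, _, .app d e => .app d.den e.den
  | _, _, _, .inl d => .inl d.den
  | _, _, _, .inr d => .inr d.den
  | _, _, _, .case d e₁ e₂ => .case d.den e₁.den e₂.den
  | _, _, _, .fst d => .fst d.den
  | _, _, _, .snd d => .snd d.den
  | _, _, _, .pair d e => .pair d.den e.den
  | _, _, _, .unfold d => .unfold d.den
  | _, _, _, .fold d => .fold d.den

/-!
## The weak-bisimulation logical relation

The relation is proof relevant: `x ≈ y` is a type depending on `x, y : ⟦σ⟧`, so at each stage it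
is a family of sets, with restriction maps from stage `n + 1` to stage `n`.
-/

/-- `iter f m = f^m`, with the last application of `f` outermost. -/
def iter {A : Type} (f : A → A) : ℕ → A → A
  | 0, x => x
  | m + 1, x => f (iter f m x)

/-- A relation at stage `n + 1` on a presheaf, with its restriction to the relation `R` that it is
at stage `n`. -/
structure RelExt {P : Type} (E : Ext P) (R : P → P → Type) : Type 1 where
  rel : E.pt → E.pt → Type
  res {x y : E.pt} : rel x y → R (E.res x) (E.res y)

/-- The relation `R + R'` on `A + B`. -/
def SumRel {A B : Type} (R : A → A → Type) (R' : B → B → Type) : A ⊕ B → A ⊕ B → Type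
  | .inl a, .inl a' => R a a'
  | .inr b, .inr b' => R' b b'
  | _, _ => Empty

def SumRel.res {P Q : Type} {A : Ext P} {B : Ext Q} {R : P → P → Type} {R' : Q → Q → Type}
    (E : RelExt A R) (F : RelExt B R') :
    (x y : (A.sum B).pt) → SumRel E.rel F.rel x y →
      SumRel R R' ((A.sum B).res x) ((A.sum B).res y)
  | .inl _, .inl _, r => E.res r
  | .inr _, .inr _, r => F.res r
  | .inl _, .inr _, r => r.elim
  | .inr _, .inl _, r => r.elim

/-- `R + R'` at stage `n + 1`. -/
def RelExt.sum {P Q : Type} {A : Ext P} {B : Ext Q} {R : P → P → Type} {R' : Q → Q → Type}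
    (E : RelExt A R) (F : RelExt B R') : RelExt (A.sum B) (SumRel R R') :=
  ⟨SumRel E.rel F.rel, fun {x y} => SumRel.res E F x y⟩

section LiftRel

variable {P LP : Type} (E : Ext P) (ret : P → LP) (delay : LP → LP)

/-- The lifting `L R` of `R` to `L A`, at stage `n + 1`, where `LR` is `L R` at stage `n`:
* `η a (L R) η b` is `a R b`,
* `η a (L R) θ y` is `Σ m b, (θ y = δ^m (η b) and a R b)`,
* `θ x (L R) η b` is `Σ m a, (θ x = δ^m (η a) and a R b)`,
* `θ x (L R) θ y` is `x (▷ L R) y`. -/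
def Ext.LiftRel (R : E.pt → E.pt → Type) (LR : LP → LP → Type) :
    (E.lift ret delay).pt → (E.lift ret delay).pt → Type
  | .inl a, .inl b => R a b
  | .inl a, .inr y =>
    Σ (m : ℕ) (b : E.pt), {_r : R a b // .inr y = iter (E.liftDelay ret delay) m (.inl b)}
  | .inr x, .inl b =>
    Σ (m : ℕ) (a : E.pt), {_r : R a b // .inr x = iter (E.liftDelay ret delay) m (.inl a)}
  | .inr x, .inr y => LR x y

theorem Ext.res_iter_liftDelay (m : ℕ) (b : E.pt) :
    (E.lift ret delay).res (iter (E.liftDelay ret delay) m (.inl b)) =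
      iter delay m (ret (E.res b)) := by
  induction m with
  | zero => rfl
  | succ m ih => exact congrArg delay ih

variable {E ret delay}

theorem Ext.iter_eq_delay {m : ℕ} {b : E.pt} {y : LP}
    (h : .inr y = iter (E.liftDelay ret delay) m (.inl b)) :
    iter delay m (ret (E.res b)) = delay y :=
  (E.res_iter_liftDelay ret delay m b).symm.trans (congrArg (E.lift ret delay).res h.symm)

/-- The restriction of `L R` from stage `n + 1` to stage `n`. It keeps the number `m` in the two
middle clauses and restricts the other components. The arguments `right`, `left` and `tick` are
the introduction rules of `L R` at stage `n`. -/
def Ext.liftRelRes {B : P → P → Type} {LR : LP → LP → Type} (R : RelExt E B)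
    (right : ∀ (m : ℕ) {a b : P}, B a b → LR (ret a) (iter delay m (ret b)))
    (left : ∀ (m : ℕ) {a b : P}, B a b → LR (iter delay m (ret a)) (ret b))
    (tick : ∀ {x y : LP}, LR x y → LR (delay x) (delay y)) :
    (x y : (E.lift ret delay).pt) → E.LiftRel ret delay R.rel LR x y →
      LR ((E.lift ret delay).res x) ((E.lift ret delay).res y)
  | .inl _, .inl _, r => right 0 (R.res r)
  | .inl a, .inr _, ⟨m, _, r, h⟩ =>
    cast (congrArg (LR (ret (E.res a))) (Ext.iter_eq_delay h)) (right m (R.res r))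
  | .inr _, .inl b, ⟨m, _, r, h⟩ =>
    cast (congrArg (LR · (ret (E.res b))) (Ext.iter_eq_delay h)) (left m (R.res r))
  | .inr _, .inr _, r => tick r

/-- `L R` at stage `n + 1`. -/
def RelExt.lift {B : P → P → Type} {LR : LP → LP → Type} (R : RelExt E B)
    (right : ∀ (m : ℕ) {a b : P}, B a b → LR (ret a) (iter delay m (ret b)))
    (left : ∀ (m : ℕ) {a b : P}, B a b → LR (iter delay m (ret a)) (ret b))
    (tick : ∀ {x y : LP}, LR x y → LR (delay x) (delay y)) : RelExt (E.lift ret delay) LR :=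
  ⟨E.LiftRel ret delay R.rel LR, fun {x y} => Ext.liftRelRes R right left tick x y⟩

/-- `η a (L R) δ^m (η b)` if `a R b`, at stage `n + 1`. -/
def Ext.liftRight (R : E.pt → E.pt → Type) (LR : LP → LP → Type) {a b : E.pt} (r : R a b) :
    (m : ℕ) → E.LiftRel ret delay R LR (.inl a) (iter (E.liftDelay ret delay) m (.inl b))
  | 0 => r
  | m + 1 => ⟨m + 1, b, r, rfl⟩

/-- `δ^m (η a) (L R) η b` if `a R b`, at stage `n + 1`. -/
def Ext.liftLeft (R : E.pt → E.pt → Type) (LR : LP → LP → Type) {a b : E.pt} (r : R a b) :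
    (m : ℕ) → E.LiftRel ret delay R LR (iter (E.liftDelay ret delay) m (.inl a)) (.inl b)
  | 0 => r
  | m + 1 => ⟨m + 1, a, r, rfl⟩

end LiftRel

/-- The equality relation on the unit type, as a type. -/
def UnitRel (a b : Unit) : Type := PLift (a = b)

/-- The relations `≈_σ` for all closed types `σ` at one stage `n`, with the closure properties at
that stage through which the restriction maps from stage `n + 1` are defined. -/
structure RelStage {n : ℕ} (S : Stage n) : Type 1 where
  /-- `x ≈_σ y` at stage `n` -/
  Rel {σ : Ty 0} : S.El σ → S.El σ → Type
  oneRight (m : ℕ) {a b : Unit} : UnitRel a b → Rel (S.retOne a) (iter S.delay m (S.retOne b))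
  oneLeft (m : ℕ) {a b : Unit} : UnitRel a b → Rel (iter S.delay m (S.retOne a)) (S.retOne b)
  oneTick {x y : S.El .one} : Rel x y → Rel (S.delay x) (S.delay y)
  sumRight {σ τ : Ty 0} (m : ℕ) {a b : S.El σ ⊕ S.El τ} :
    SumRel Rel Rel a b → Rel (S.ret a) (iter S.delay m (S.ret b))
  sumLeft {σ τ : Ty 0} (m : ℕ) {a b : S.El σ ⊕ S.El τ} :
    SumRel Rel Rel a b → Rel (iter S.delay m (S.ret a)) (S.ret b)
  sumTick {σ τ : Ty 0} {x y : S.El (.sum σ τ)} : Rel x y → Rel (S.delay x) (S.delay y)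
  pair {σ τ : Ty 0} {x x' : S.El σ} {y y' : S.El τ} :
    Rel x x' → Rel y y' → Rel (S.pair x y) (S.pair x' y')
  app {σ τ : Ty 0} {f g : S.El (.arrow σ τ)} {x y : S.El σ} :
    Rel f g → Rel x y → Rel (S.app f x) (S.app g y)
  next {τ : Ty 1} {x y : S.El τ.unfold} : Rel x y → Rel (S.next x) (S.next y)

/-- Stage `0`, at which every relation holds in exactly one way. -/
def RelStage.zero : RelStage Stage.zero where
  Rel _ _ := PUnit
  oneRight _ _ _ _ := ⟨⟩
  oneLeft _ _ _ _ := ⟨⟩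
  oneTick _ := ⟨⟩
  sumRight _ _ _ _ := ⟨⟩
  sumLeft _ _ _ _ := ⟨⟩
  sumTick _ := ⟨⟩
  pair _ _ := ⟨⟩
  app _ _ := ⟨⟩
  next _ := ⟨⟩

/-- `≈_σ` at stage `n + 1`, with the restriction to stage `n`:
* `≈_1` is `L (=)` and `≈_(σ + τ)` is `L (≈_σ + ≈_τ)`,
* `x ≈_(σ × τ) y` is `π₁ x ≈_σ π₁ y` and `π₂ x ≈_τ π₂ y`,
* `f ≈_(σ → τ) g` is `Π x y, x ≈_σ y → f x ≈_τ g y`, whose elements at stage `n + 1` are the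
  families `x ≈_σ y → f x ≈_τ g y`, for `x` and `y` at stages `m ≤ n + 1`, that commute with
  restriction: such a family at stage `n` with a compatible family at stage `n + 1`,
* `x ≈_(μα.τ) y` is `x (▷ ≈_(τ[μα.τ/α])) y`. -/
def RelStage.ext {n : ℕ} {S : Stage n} (R : RelStage S) (σ : Ty 0) : RelExt (S.ext σ) (R.Rel (σ := σ)) :=
  Ty.closedRec (M := fun σ => RelExt (S.ext σ) (R.Rel (σ := σ)))
    (one := (RelExt.mk (E := ⟨Unit, id⟩) UnitRel id).lift R.oneRight R.oneLeft R.oneTick)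
    (sum := fun _ _ E F => (E.sum F).lift R.sumRight R.sumLeft R.sumTick)
    (prod := fun _ _ E F =>
      ⟨fun x y => E.rel x.1 y.1 × F.rel x.2 y.2, fun r => R.pair (E.res r.1) (F.res r.2)⟩)
    (arrow := fun _ _ E F =>
      ⟨fun f g =>
        {p : R.Rel f.1.1 g.1.1 × (∀ x y, E.rel x y → F.rel (f.1.2 x) (g.1.2 y)) //
          ∀ x y (r : E.rel x y), HEq (F.res (p.2 x y r)) (R.app p.1 (E.res r))},
        fun p => p.1.1⟩)
    (mu := fun _ => ⟨fun x y => R.Rel x y, R.next⟩) σ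

/-- Stage `n + 1`, from stage `n`. -/
def RelStage.succ {n : ℕ} {S : Stage n} (R : RelStage S) : RelStage S.succ where
  Rel {σ} x y := (R.ext σ).rel x y
  oneRight m _ _ r := Ext.liftRight _ _ r m
  oneLeft m _ _ r := Ext.liftLeft _ _ r m
  oneTick r := (R.ext .one).res r
  sumRight m _ _ r := Ext.liftRight _ _ r m
  sumLeft m _ _ r := Ext.liftLeft _ _ r m
  sumTick {σ τ} _ _ r := (R.ext (.sum σ τ)).res r
  pair r s := (r, s)
  app p r := p.1.2 _ _ r
  next {τ} _ _ r := (R.ext τ.unfold).res r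

def relStage : (n : ℕ) → RelStage (stage n)
  | 0 => RelStage.zero
  | n + 1 => (relStage n).succ

/-- The type `x ≈_σ y` at stage `n`. -/
abbrev Rel {n : ℕ} {σ : Ty 0} (x y : El n σ) : Type := (relStage n).Rel x y

/-- The restriction maps of `≈_σ`. -/
def Rel.res {n : ℕ} {σ : Ty 0} {x y : El (n + 1) σ} (r : Rel x y) : Rel (FPC.res x) (FPC.res y) :=
  ((relStage n).ext σ).res r

/-- The type `γ ≈_Γ γ'` of componentwise related environments, at stage `n`. -/
def EnvRel {n : ℕ} : {Γ : Ctx} → Env n Γ → Env n Γ → Type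
  | [], _, _ => Unit
  | _ :: _, γ, γ' => Rel γ.1 γ'.1 × EnvRel γ.2 γ'.2

def EnvRel.res {n : ℕ} : {Γ : Ctx} → {γ γ' : Env (n + 1) Γ} → EnvRel γ γ' → EnvRel γ.res γ'.res
  | [], _, _, _ => ()
  | _ :: _, _, _, r => (Rel.res r.1, EnvRel.res r.2)

/-- The (global) elements of the type
`f ≈_{Γ,σ} g := Π γ γ' : ⟦Γ⟧, γ ≈_Γ γ' → f γ ≈_σ g γ'`, that is, the families of maps
`γ ≈_Γ γ' → f γ ≈_σ g γ'` at all stages that commute with restriction. -/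
structure OpenRel {Γ : Ctx} {σ : Ty 0} (f g : Hom Γ σ) : Type where
  map (n : ℕ) {γ γ' : Env n Γ} : EnvRel γ γ' → Rel (f.map n γ) (g.map n γ')
  nat (n : ℕ) {γ γ' : Env (n + 1) Γ} (r : EnvRel γ γ') :
    HEq (map (n + 1) r).res (map n r.res)

/-! ## A function that is not related to itself -/

/-- The divergent computation `⊥ = fix θ` in `⟦1⟧ = L 1`. -/
def bot : (n : ℕ) → El n .one
  | 0 => ⟨⟩
  | n + 1 => theta (bot n)

theorem delay_bot : (n : ℕ) → (stage n).delay (bot n) = bot n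
  | 0 => rfl
  | n + 1 => congrArg theta ((res_theta (bot n)).trans (delay_bot n))

def isNowMap : (n : ℕ) → El n .one → El n .one
  | 0, _ => ⟨⟩
  | _ + 1, .inl a => .inl a
  | n + 1, .inr _ => bot (n + 1)

theorem isNowMap_nat : (n : ℕ) → (x : El (n + 1) .one) →
    res (isNowMap (n + 1) x) = isNowMap n (res x)
  | 0, _ => rfl
  | _ + 1, .inl _ => rfl
  | n + 1, .inr _ => (res_theta (bot (n + 1))).trans (delay_bot (n + 1))

/-- The function `⟦1⟧ → ⟦1⟧` with `η(*) ↦ η(*)` and `θ(x) ↦ ⊥`, as an element of `⟦1 → 1⟧`. -/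
def isNow : Hom [] (.arrow .one .one) :=
  Hom.lam ⟨fun n γ => isNowMap n γ.1, fun n γ => isNowMap_nat n γ.1⟩

end FPC

namespace FPC

/-! ## Heterogeneous equality in relations -/

/-! The positive half is the fundamental lemma of a logical relation, by induction on typing
derivations; `unfold` and `case` carry the content. For them the relation needs two closure
properties at every closed type: related elements of `▷⟦σ⟧` stay related under `θ`, and `x ≈ y`
implies both `x ≈ δ y` and `δ x ≈ y`. The second serves `case`: if the scrutinees are `η a` and `δ^m
(η b)`, the results are `h (η a)` and `h (δ^m (η b)) = δ^m (h (η b))`, because `h` is a homomorphism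
of `▷`-algebras, so `m` delays must be absorbed on one side at the result type.

Both properties are proved by guarded recursion together with induction on the type. Products and
functions are handled componentwise and pointwise, recursive types by the guarded hypothesis alone.
On `L R` the clauses with one `η` record the number of delays explicitly. Adding a delay on the side
of the `θ` raises that number; adding it on the side of the `η` leaves two `θ`s, whose arguments are
related one stage earlier with one delay fewer.

Since the relation is proof relevant, every such construction must commute with restriction.
`RelStage.Ops` collects the operations at stage `n` and the equations among them that make the
construction of stage `n + 1` natural; `extTheta`, `extRight`, `extLeft` and `Ops.succ` carry the
step. Restriction changes endpoints along equalities that are often only propositional, so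
naturality is stated with heterogeneous equality.

The negative half uses the recorded number. Applied to `η * ≈ δ (η *)`, a proof of self-relatedness
gives a global element of `η * ≈ ⊥`. Its number of delays is preserved by restriction, hence is one
fixed `m` for all stages; but `⊥` and `δ^m (η *)` differ at stage `m + 1`. -/

theorem heq_map {A : Type} {R S : A → A → Type} (f : ∀ x y, R x y → S x y)
    {x x' y y' : A} {r : R x y} {r' : R x' y'} (hx : x = x') (hy : y = y') (h : r ≍ r') :
    f x y r ≍ f x' y' r' := by
  subst hx hy h
  rfl

/-- Transport of an element of `R x y` along equalities of `x` and `y`. -/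
def castRel {A : Type} (R : A → A → Type) {x x' y y' : A} (hx : x = x') (hy : y = y')
    (r : R x y) : R x' y' :=
  cast (congrArg₂ R hx hy) r

theorem castRel_heq {A : Type} (R : A → A → Type) {x x' y y' : A} (hx : x = x') (hy : y = y')
    (r : R x y) : castRel R hx hy r ≍ r :=
  cast_heq _ r

theorem map_castRel_heq {A : Type} {R S : A → A → Type} (f : ∀ x y, R x y → S x y)
    {x x' y y' : A} (hx : x = x') (hy : y = y') (r : R x y) :
    f x' y' (castRel R hx hy r) ≍ f x y r :=
  heq_map f hx.symm hy.symm (castRel_heq R hx hy r)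

/-! ## The lifted relation absorbs delays -/

/-- The laws of the lifting `LR` of a relation `B` at one stage, where `shiftR` and `shiftL` add a
delay on the right and on the left. -/
structure LiftLaws {P LP : Type} {ret : P → LP} {delay : LP → LP} {B : P → P → Type}
    {LR : LP → LP → Type}
    (right : ∀ (m : ℕ) {a b : P}, B a b → LR (ret a) (iter delay m (ret b)))
    (left : ∀ (m : ℕ) {a b : P}, B a b → LR (iter delay m (ret a)) (ret b))
    (tick : ∀ {x y : LP}, LR x y → LR (delay x) (delay y))
    (shiftR : ∀ {x y : LP}, LR x y → LR x (delay y))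
    (shiftL : ∀ {x y : LP}, LR x y → LR (delay x) y) : Prop where
  left_zero {a b : P} (r : B a b) : left 0 r = right 0 r
  shiftR_right (m : ℕ) {a b : P} (r : B a b) : shiftR (right m r) = right (m + 1) r
  shiftR_left (m : ℕ) {a b : P} (r : B a b) : shiftR (left (m + 1) r) = tick (left m r)
  shiftR_tick {x y : LP} (r : LR x y) : shiftR (tick r) = tick (shiftR r)
  shiftL_left (m : ℕ) {a b : P} (r : B a b) : shiftL (left m r) = left (m + 1) r
  shiftL_right (m : ℕ) {a b : P} (r : B a b) : shiftL (right (m + 1) r) = tick (right m r)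
  shiftL_tick {x y : LP} (r : LR x y) : shiftL (tick r) = tick (shiftL r)

section

variable {P LP : Type} {E : Ext P} {ret : P → LP} {delay : LP → LP} {B : P → P → Type}
  {LR : LP → LP → Type}

/-- Injectivity of `θ` strips one delay; what remains lives one stage earlier. -/
theorem Ext.eq_iter_of_inr_eq {m : ℕ} {a : E.pt} {x : LP}
    (h : .inr x = iter (E.liftDelay ret delay) (m + 1) (.inl a)) :
    iter delay m (ret (E.res a)) = x :=
  (E.res_iter_liftDelay ret delay m a).symm.trans (Sum.inr.inj h).symm

/-- `x (L R) δ y` if `x (L R) y`, at stage `n + 1`. -/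
def Ext.shiftRight (R : RelExt E B)
    (left : ∀ (m : ℕ) {a b : P}, B a b → LR (iter delay m (ret a)) (ret b))
    (shiftR : ∀ {x y : LP}, LR x y → LR x (delay y)) :
    (x y : (E.lift ret delay).pt) → E.LiftRel ret delay R.rel LR x y →
      E.LiftRel ret delay R.rel LR x (E.liftDelay ret delay y)
  | .inl _, .inl b, r => ⟨1, b, r, rfl⟩
  | .inl _, .inr _, ⟨m, b, r, h⟩ => ⟨m + 1, b, r, congrArg (E.liftDelay ret delay) h⟩
  -- No delay at all is impossible, since an `η` is never a `θ`. Now both sides are `θ`, and the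
  -- goal is the relation at stage `n` between `δ^m (η a)` and `η b`, which is `left m`.
  | .inr _, .inl b, ⟨m + 1, _, r, h⟩ =>
    cast (congrArg (LR · (ret (E.res b))) (Ext.eq_iter_of_inr_eq h)) (left m (R.res r))
  | .inr _, .inr _, r => shiftR r

/-- `δ x (L R) y` if `x (L R) y`, at stage `n + 1`. -/
def Ext.shiftLeft (R : RelExt E B)
    (right : ∀ (m : ℕ) {a b : P}, B a b → LR (ret a) (iter delay m (ret b)))
    (shiftL : ∀ {x y : LP}, LR x y → LR (delay x) y) :
    (x y : (E.lift ret delay).pt) → E.LiftRel ret delay R.rel LR x y →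
      E.LiftRel ret delay R.rel LR (E.liftDelay ret delay x) y
  | .inl a, .inl _, r => ⟨1, a, r, rfl⟩
  | .inr _, .inl _, ⟨m, a, r, h⟩ => ⟨m + 1, a, r, congrArg (E.liftDelay ret delay) h⟩
  | .inl a, .inr _, ⟨m + 1, _, r, h⟩ =>
    cast (congrArg (LR (ret (E.res a))) (Ext.eq_iter_of_inr_eq h)) (right m (R.res r))
  | .inr _, .inr _, r => shiftL r

variable {right : ∀ (m : ℕ) {a b : P}, B a b → LR (ret a) (iter delay m (ret b))}
  {left : ∀ (m : ℕ) {a b : P}, B a b → LR (iter delay m (ret a)) (ret b)}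
  {tick : ∀ {x y : LP}, LR x y → LR (delay x) (delay y)}
  {shiftR : ∀ {x y : LP}, LR x y → LR x (delay y)}
  {shiftL : ∀ {x y : LP}, LR x y → LR (delay x) y}

/-- Each clause of `Ext.shiftRight` reduces to one law of `H` at stage `n`: `shiftR_right` when the
left side is an `η`, `shiftR_left` when only the right side is, `shiftR_tick` when neither is. The
rest removes the casts that the two constructions insert. -/
theorem LiftLaws.res_shiftRight (H : LiftLaws right left tick shiftR shiftL) (R : RelExt E B) :
    (x y : (E.lift ret delay).pt) → (r : E.LiftRel ret delay R.rel LR x y) →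
    Ext.liftRelRes R right left tick _ _ (Ext.shiftRight R left shiftR x y r) ≍
      shiftR (Ext.liftRelRes R right left tick x y r)
  | .inl _, .inl _, r =>
    heq_of_eq (H.shiftR_right 0 (R.res r)).symm
  | .inl a, .inr _, ⟨m, _, r, h⟩ =>
    have h₂ := heq_map (S := fun x y => LR x (delay y)) (fun _ _ r => shiftR r)
      rfl (Ext.iter_eq_delay h)
      (cast_heq (congrArg (LR (ret (E.res a))) (Ext.iter_eq_delay h)) (right m (R.res r))).symm
    (cast_heq _ (right (m + 1) (R.res r))).trans <|
      (heq_of_eq (H.shiftR_right m (R.res r)).symm).trans h₂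
  | .inr _, .inl b, ⟨m + 1, _, r, h⟩ =>
    have h₁ := heq_map (S := fun x y => LR (delay x) (delay y)) (fun _ _ r => tick r)
      (Ext.eq_iter_of_inr_eq h) rfl
      (cast_heq (congrArg (LR · (ret (E.res b))) (Ext.eq_iter_of_inr_eq h))
        (left m (R.res r))).symm
    have h₂ := heq_map (S := fun x y => LR x (delay y)) (fun _ _ r => shiftR r)
      (Ext.iter_eq_delay h) rfl
      (cast_heq (congrArg (LR · (ret (E.res b))) (Ext.iter_eq_delay h))
        (left (m + 1) (R.res r))).symm
    h₁.symm.trans ((heq_of_eq (H.shiftR_left m (R.res r)).symm).trans h₂)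
  | .inr _, .inr _, r => heq_of_eq (H.shiftR_tick r).symm

theorem LiftLaws.res_shiftLeft (H : LiftLaws right left tick shiftR shiftL) (R : RelExt E B) :
    (x y : (E.lift ret delay).pt) → (r : E.LiftRel ret delay R.rel LR x y) →
    Ext.liftRelRes R right left tick _ _ (Ext.shiftLeft R right shiftL x y r) ≍
      shiftL (Ext.liftRelRes R right left tick x y r)
  | .inl _, .inl _, r =>
    heq_of_eq ((H.shiftL_left 0 (R.res r)).symm.trans (congrArg shiftL (H.left_zero (R.res r))))
  | .inr _, .inl b, ⟨m, _, r, h⟩ =>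
    have h₂ := heq_map (S := fun x y => LR (delay x) y) (fun _ _ r => shiftL r)
      (Ext.iter_eq_delay h) rfl
      (cast_heq (congrArg (LR · (ret (E.res b))) (Ext.iter_eq_delay h)) (left m (R.res r))).symm
    (cast_heq _ (left (m + 1) (R.res r))).trans <|
      (heq_of_eq (H.shiftL_left m (R.res r)).symm).trans h₂
  | .inl a, .inr _, ⟨m + 1, _, r, h⟩ =>
    have h₁ := heq_map (S := fun x y => LR (delay x) (delay y)) (fun _ _ r => tick r)
      rfl (Ext.eq_iter_of_inr_eq h)
      (cast_heq (congrArg (LR (ret (E.res a))) (Ext.eq_iter_of_inr_eq h))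
        (right m (R.res r))).symm
    have h₂ := heq_map (S := fun x y => LR (delay x) y) (fun _ _ r => shiftL r)
      rfl (Ext.iter_eq_delay h)
      (cast_heq (congrArg (LR (ret (E.res a))) (Ext.iter_eq_delay h))
        (right (m + 1) (R.res r))).symm
    h₁.symm.trans ((heq_of_eq (H.shiftL_right m (R.res r)).symm).trans h₂)
  | .inr _, .inr _, r => heq_of_eq (H.shiftL_tick r).symm

/-- At stage `n + 1` the operation `tick` is restriction followed by the `θ`-`θ` clause. The two
laws about shifting a `tick` therefore become naturality of the shifts; the others hold essentially
by computation. -/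
theorem LiftLaws.succ (H : LiftLaws right left tick shiftR shiftL) (R : RelExt E B) :
    LiftLaws (ret := Sum.inl) (delay := E.liftDelay ret delay) (B := R.rel)
      (LR := E.LiftRel ret delay R.rel LR)
      (fun m {_ _} r => Ext.liftRight R.rel LR r m) (fun m {_ _} r => Ext.liftLeft R.rel LR r m)
      (fun {x y} r => Ext.liftRelRes R right left tick x y r)
      (fun {x y} r => Ext.shiftRight R left shiftR x y r)
      (fun {x y} r => Ext.shiftLeft R right shiftL x y r) where
  left_zero _ := rfl
  shiftR_right m _ _ r := by cases m <;> rfl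
  shiftR_left m _ _ r := by
    cases m with
    -- Stripping the only delay yields `left 0`, whereas restricting a pair of `η`s yields `right
    -- 0`.
    | zero => exact H.left_zero _
    | succ m => rfl
  shiftR_tick {x y} r := (eq_of_heq (H.res_shiftRight R x y r)).symm
  shiftL_left m _ _ r := by cases m <;> rfl
  shiftL_right m _ _ r := by cases m <;> rfl
  shiftL_tick {x y} r := (eq_of_heq (H.res_shiftLeft R x y r)).symm

end

/-! ### Closure of `≈_σ` under `θ` and one-sided delays -/

theorem heq_map₂ {A B C : Type} {R : A → A → Type} {S : B → B → Type} {c : A → B → C}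
    {T : C → C → Type} (f : ∀ x x' y y', R x x' → S y y' → T (c x y) (c x' y'))
    {x₁ x₁' x₂ x₂' : A} {y₁ y₁' y₂ y₂' : B} {r₁ : R x₁ x₁'} {r₂ : R x₂ x₂'} {s₁ : S y₁ y₁'}
    {s₂ : S y₂ y₂'} (hx : x₁ = x₂) (hx' : x₁' = x₂') (hy : y₁ = y₂) (hy' : y₁' = y₂')
    (hr : r₁ ≍ r₂) (hs : s₁ ≍ s₂) : f x₁ x₁' y₁ y₁' r₁ s₁ ≍ f x₂ x₂' y₂ y₂' r₂ s₂ := by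
  subst hx hx' hy hy' hr hs
  rfl

namespace RelStage

variable {n : ℕ} {S : Stage n}

/-- The operations on the relations `≈_σ` at stage `n` through which the corresponding operations
at stage `n + 1` are defined: `right` and `left` add a delay on one side. -/
structure Ops (R : RelStage S) : Type where
  fst {σ τ : Ty 0} {x y : S.El (.prod σ τ)} : R.Rel x y → R.Rel (S.fst x) (S.fst y)
  snd {σ τ : Ty 0} {x y : S.El (.prod σ τ)} : R.Rel x y → R.Rel (S.snd x) (S.snd y)
  unfold {τ : Ty 1} {x y : S.El (.mu τ)} : R.Rel x y → R.Rel (S.unfold x) (S.unfold y)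
  tick {σ : Ty 0} {x y : S.El σ} : R.Rel x y → R.Rel (S.delay x) (S.delay y)
  right {σ : Ty 0} {x y : S.El σ} : R.Rel x y → R.Rel x (S.delay y)
  left {σ : Ty 0} {x y : S.El σ} : R.Rel x y → R.Rel (S.delay x) y
  one : LiftLaws R.oneRight R.oneLeft R.oneTick right left
  sum (σ τ : Ty 0) : LiftLaws (R.sumRight (σ := σ) (τ := τ)) R.sumLeft R.sumTick right left
  tick_one {x y : S.El .one} (r : R.Rel x y) : tick r = R.oneTick r
  tick_sum {σ τ : Ty 0} {x y : S.El (.sum σ τ)} (r : R.Rel x y) : tick r = R.sumTick r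
  fst_pair {σ τ : Ty 0} {x x' : S.El σ} {y y' : S.El τ} (r : R.Rel x x') (s : R.Rel y y') :
    fst (R.pair r s) ≍ r
  snd_pair {σ τ : Ty 0} {x x' : S.El σ} {y y' : S.El τ} (r : R.Rel x x') (s : R.Rel y y') :
    snd (R.pair r s) ≍ s
  pair_tick {σ τ : Ty 0} {x y : S.El (.prod σ τ)} (r : R.Rel x y) :
    R.pair (tick (fst r)) (tick (snd r)) ≍ tick r
  pair_right {σ τ : Ty 0} {x x' : S.El σ} {y y' : S.El τ} (r : R.Rel x x') (s : R.Rel y y') :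
    R.pair (right r) (right s) ≍ right (R.pair r s)
  pair_left {σ τ : Ty 0} {x x' : S.El σ} {y y' : S.El τ} (r : R.Rel x x') (s : R.Rel y y') :
    R.pair (left r) (left s) ≍ left (R.pair r s)
  app_tick {σ τ : Ty 0} {f g : S.El (.arrow σ τ)} {x y : S.El σ} (p : R.Rel f g)
    (r : R.Rel x y) : R.app (tick p) r ≍ tick (R.app p r)
  app_right {σ τ : Ty 0} {f g : S.El (.arrow σ τ)} {x y : S.El σ} (p : R.Rel f g)
    (r : R.Rel x y) : R.app (right p) r ≍ right (R.app p r)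
  app_left {σ τ : Ty 0} {f g : S.El (.arrow σ τ)} {x y : S.El σ} (p : R.Rel f g)
    (r : R.Rel x y) : R.app (left p) r ≍ left (R.app p r)
  unfold_next {τ : Ty 1} {x y : S.El τ.unfold} (r : R.Rel x y) : unfold (R.next r) ≍ tick r
  next_unfold {τ : Ty 1} {x y : S.El (.mu τ)} (r : R.Rel x y) : R.next (unfold r) ≍ tick r
  next_right {τ : Ty 1} {x y : S.El τ.unfold} (r : R.Rel x y) :
    R.next (right r) ≍ right (R.next r)
  next_left {τ : Ty 1} {x y : S.El τ.unfold} (r : R.Rel x y) : R.next (left r) ≍ left (R.next r)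

def Ops.zero : RelStage.zero.Ops where
  fst _ := ⟨⟩
  snd _ := ⟨⟩
  unfold _ := ⟨⟩
  tick _ := ⟨⟩
  right _ := ⟨⟩
  left _ := ⟨⟩
  one := by constructor <;> intros <;> rfl
  sum _ _ := by constructor <;> intros <;> rfl
  tick_one _ := rfl
  tick_sum _ := rfl
  fst_pair _ _ := HEq.rfl
  snd_pair _ _ := HEq.rfl
  pair_tick _ := HEq.rfl
  pair_right _ _ := HEq.rfl
  pair_left _ _ := HEq.rfl
  app_tick _ _ := HEq.rfl
  app_right _ _ := HEq.rfl
  app_left _ _ := HEq.rfl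
  unfold_next _ := HEq.rfl
  next_unfold _ := HEq.rfl
  next_right _ := HEq.rfl
  next_left _ := HEq.rfl

variable {R : RelStage S}

theorem pair_heq (R : RelStage S) {σ τ : Ty 0} {x₁ x₁' x₂ x₂' : S.El σ} {y₁ y₁' y₂ y₂' : S.El τ}
    {r₁ : R.Rel x₁ x₁'} {r₂ : R.Rel x₂ x₂'} {s₁ : R.Rel y₁ y₁'} {s₂ : R.Rel y₂ y₂'}
    (hx : x₁ = x₂) (hx' : x₁' = x₂') (hy : y₁ = y₂) (hy' : y₁' = y₂')
    (hr : r₁ ≍ r₂) (hs : s₁ ≍ s₂) : R.pair r₁ s₁ ≍ R.pair r₂ s₂ :=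
  heq_map₂ (fun _ _ _ _ r s => R.pair r s) hx hx' hy hy' hr hs

/-- `θ x ≈_σ θ y` at stage `n + 1` if `x ≈_σ y` at stage `n`. -/
def extTheta (O : R.Ops) (σ : Ty 0) :
    {t : ∀ x y, R.Rel x y → (R.ext σ).rel ((S.theta σ).1 x) ((S.theta σ).1 y) //
      ∀ x y r, (R.ext σ).res (t x y r) ≍ O.tick r} :=
  Ty.closedRec
    (M := fun σ => {t : ∀ x y, R.Rel x y → (R.ext σ).rel ((S.theta σ).1 x) ((S.theta σ).1 y) //
      ∀ x y r, (R.ext σ).res (t x y r) ≍ O.tick r})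
    (one := ⟨fun _ _ r => r, fun _ _ r => heq_of_eq (O.tick_one r).symm⟩)
    (sum := fun _ _ _ _ => ⟨fun _ _ r => r, fun _ _ r => heq_of_eq (O.tick_sum r).symm⟩)
    (prod := fun σ τ s t =>
      ⟨fun _ _ r => (s.1 _ _ (O.fst r), t.1 _ _ (O.snd r)), fun x y r =>
        (R.pair_heq ((S.theta σ).2 (S.fst x)) ((S.theta σ).2 (S.fst y)) ((S.theta τ).2 (S.snd x))
          ((S.theta τ).2 (S.snd y)) (s.2 _ _ _) (t.2 _ _ _)).trans (O.pair_tick r)⟩)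
    (arrow := fun σ _ _ t =>
      -- As `θ f x = θ (f ⊛ next x)`, the stage `n + 1` family restricts its argument, applies `p`
      -- at stage `n`, and then uses `θ` at the codomain; `app_tick` makes it compatible with the
      -- stage `n` component.
      ⟨fun _ _ p => ⟨(O.tick p, fun _ _ r => t.1 _ _ (R.app p ((R.ext σ).res r))), fun _ _ r =>
        (t.2 _ _ _).trans (O.app_tick p ((R.ext σ).res r)).symm⟩, fun _ _ _ => HEq.rfl⟩)
    (mu := fun _ => ⟨fun _ _ r => O.unfold r, fun _ _ r => O.next_unfold r⟩) σ

/-- `x ≈_σ δ y` at stage `n + 1` if `x ≈_σ y`. -/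
def extRight (O : R.Ops) (σ : Ty 0) :
    {t : ∀ x y, (R.ext σ).rel x y → (R.ext σ).rel x ((S.theta σ).1 ((S.ext σ).res y)) //
      ∀ x y r, (R.ext σ).res (t x y r) ≍ O.right ((R.ext σ).res r)} :=
  Ty.closedRec
    (M := fun σ =>
      {t : ∀ x y, (R.ext σ).rel x y → (R.ext σ).rel x ((S.theta σ).1 ((S.ext σ).res y)) //
        ∀ x y r, (R.ext σ).res (t x y r) ≍ O.right ((R.ext σ).res r)})
    (one := ⟨Ext.shiftRight _ R.oneLeft O.right, O.one.res_shiftRight _⟩)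
    (sum := fun σ τ _ _ => ⟨Ext.shiftRight _ R.sumLeft O.right, (O.sum σ τ).res_shiftRight _⟩)
    (prod := fun σ τ s t =>
      -- The delay of a pair is computed from the projections of the restricted pair. At an
      -- arbitrary stage these agree with the restricted components only propositionally, which
      -- forces the casts below.
      have h (x : S.succ.El (.prod σ τ)) :=
        congrArg (S.theta σ).1 (S.fst_pair ((S.ext σ).res x.1) ((S.ext τ).res x.2)).symm
      have h' (x : S.succ.El (.prod σ τ)) :=
        congrArg (S.theta τ).1 (S.snd_pair ((S.ext σ).res x.1) ((S.ext τ).res x.2)).symm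
      ⟨fun _ y r => (castRel (R.ext σ).rel rfl (h y) (s.1 _ _ r.1),
          castRel (R.ext τ).rel rfl (h' y) (t.1 _ _ r.2)), fun _ y r =>
        (R.pair_heq rfl ((congrArg _ (h y).symm).trans ((S.theta σ).2 _))
          rfl ((congrArg _ (h' y).symm).trans ((S.theta τ).2 _))
          ((map_castRel_heq (R := (R.ext σ).rel) (fun _ _ r => (R.ext σ).res r) rfl (h y)
            (s.1 _ _ r.1)).trans (s.2 _ _ r.1))
          ((map_castRel_heq (R := (R.ext τ).rel) (fun _ _ r => (R.ext τ).res r) rfl (h' y)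
            (t.1 _ _ r.2)).trans (t.2 _ _ r.2))).trans
          (O.pair_right ((R.ext σ).res r.1) ((R.ext τ).res r.2))⟩)
    (arrow := fun σ τ _ t =>
      -- The value of `δ g` at `y` is `θ` of the stage `n` part of `g` at the restricted `y`;
      -- naturality of `g` identifies it with the delay of `g y`, where the induction hypothesis
      -- applies.
      ⟨fun f g p => ⟨(O.right p.1.1, fun x y r =>
          castRel (R.ext τ).rel rfl (congrArg (S.theta τ).1 (g.2 y)) (t.1 _ _ (p.1.2 x y r))),
        fun x y r =>
          (map_castRel_heq (R := (R.ext τ).rel) (fun _ _ r => (R.ext τ).res r) rfl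
            (congrArg (S.theta τ).1 (g.2 y))
            (t.1 _ _ (p.1.2 x y r))).trans <| (t.2 _ _ (p.1.2 x y r)).trans <|
          (heq_map (R := R.Rel) (fun _ _ r => O.right r) (f.2 x) (g.2 y) (p.2 x y r)).trans
          (O.app_right p.1.1 ((R.ext σ).res r)).symm⟩, fun _ _ _ => HEq.rfl⟩)
    (mu := fun _ =>
      -- Here the restriction is `next` and `θ` is `unfold`, so the required endpoint `unfold (next
      -- y)` is `δ y` at stage `n`.
      ⟨fun _ y r => castRel R.Rel rfl (S.unfold_next y).symm (O.right r), fun _ y r =>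
        (map_castRel_heq (S := fun x y => R.Rel (S.next x) (S.next y)) (fun _ _ r => R.next r)
          rfl (S.unfold_next y).symm (O.right r)).trans (O.next_right r)⟩) σ

/-- `δ x ≈_σ y` at stage `n + 1` if `x ≈_σ y`. -/
def extLeft (O : R.Ops) (σ : Ty 0) :
    {t : ∀ x y, (R.ext σ).rel x y → (R.ext σ).rel ((S.theta σ).1 ((S.ext σ).res x)) y //
      ∀ x y r, (R.ext σ).res (t x y r) ≍ O.left ((R.ext σ).res r)} :=
  Ty.closedRec
    (M := fun σ =>
      {t : ∀ x y, (R.ext σ).rel x y → (R.ext σ).rel ((S.theta σ).1 ((S.ext σ).res x)) y //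
        ∀ x y r, (R.ext σ).res (t x y r) ≍ O.left ((R.ext σ).res r)})
    (one := ⟨Ext.shiftLeft _ R.oneRight O.left, O.one.res_shiftLeft _⟩)
    (sum := fun σ τ _ _ => ⟨Ext.shiftLeft _ R.sumRight O.left, (O.sum σ τ).res_shiftLeft _⟩)
    (prod := fun σ τ s t =>
      have h (x : S.succ.El (.prod σ τ)) :=
        congrArg (S.theta σ).1 (S.fst_pair ((S.ext σ).res x.1) ((S.ext τ).res x.2)).symm
      have h' (x : S.succ.El (.prod σ τ)) :=
        congrArg (S.theta τ).1 (S.snd_pair ((S.ext σ).res x.1) ((S.ext τ).res x.2)).symm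
      ⟨fun x _ r => (castRel (R.ext σ).rel (h x) rfl (s.1 _ _ r.1),
          castRel (R.ext τ).rel (h' x) rfl (t.1 _ _ r.2)), fun x _ r =>
        (R.pair_heq ((congrArg _ (h x).symm).trans ((S.theta σ).2 _)) rfl
          ((congrArg _ (h' x).symm).trans ((S.theta τ).2 _)) rfl
          ((map_castRel_heq (R := (R.ext σ).rel) (fun _ _ r => (R.ext σ).res r) (h x) rfl
            (s.1 _ _ r.1)).trans (s.2 _ _ r.1))
          ((map_castRel_heq (R := (R.ext τ).rel) (fun _ _ r => (R.ext τ).res r) (h' x) rfl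
            (t.1 _ _ r.2)).trans (t.2 _ _ r.2))).trans
          (O.pair_left ((R.ext σ).res r.1) ((R.ext τ).res r.2))⟩)
    (arrow := fun σ τ _ t =>
      ⟨fun f g p => ⟨(O.left p.1.1, fun x y r =>
          castRel (R.ext τ).rel (congrArg (S.theta τ).1 (f.2 x)) rfl (t.1 _ _ (p.1.2 x y r))),
        fun x y r =>
          (map_castRel_heq (R := (R.ext τ).rel) (fun _ _ r => (R.ext τ).res r)
            (congrArg (S.theta τ).1 (f.2 x)) rfl
            (t.1 _ _ (p.1.2 x y r))).trans <| (t.2 _ _ (p.1.2 x y r)).trans <|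
          (heq_map (R := R.Rel) (fun _ _ r => O.left r) (f.2 x) (g.2 y) (p.2 x y r)).trans
          (O.app_left p.1.1 ((R.ext σ).res r)).symm⟩, fun _ _ _ => HEq.rfl⟩)
    (mu := fun _ =>
      ⟨fun x _ r => castRel R.Rel (S.unfold_next x).symm rfl (O.left r), fun x _ r =>
        (map_castRel_heq (S := fun x y => R.Rel (S.next x) (S.next y)) (fun _ _ r => R.next r)
          (S.unfold_next x).symm rfl (O.left r)).trans (O.next_left r)⟩) σ

theorem prod_mk_heq {A A' B B' : Type} {a : A} {a' : A'} {b : B} {b' : B'} (ha : a ≍ a')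
    (hb : b ≍ b') : (a, b) ≍ (a', b') := by
  cases ha
  cases hb
  rfl

/-- Stage `n + 1`, from stage `n`. -/
def Ops.succ (O : R.Ops) : R.succ.Ops where
  fst r := r.1
  snd r := r.2
  unfold {τ} _ _ r := (extTheta O τ.unfold).1 _ _ r
  tick {σ} _ _ r := (extTheta O σ).1 _ _ ((R.ext σ).res r)
  right {σ} _ _ r := (extRight O σ).1 _ _ r
  left {σ} _ _ r := (extLeft O σ).1 _ _ r
  one := O.one.succ (RelExt.mk (E := ⟨Unit, id⟩) UnitRel id)
  sum σ τ := (O.sum σ τ).succ ((R.ext σ).sum (R.ext τ))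
  tick_one _ := rfl
  tick_sum _ := rfl
  fst_pair _ _ := HEq.rfl
  snd_pair _ _ := HEq.rfl
  pair_tick {σ τ} _ _ r :=
    prod_mk_heq
      (heq_map (R := R.Rel) (fun _ _ r => (extTheta O σ).1 _ _ r) (S.fst_pair _ _).symm
        (S.fst_pair _ _).symm (O.fst_pair ((R.ext σ).res r.1) ((R.ext τ).res r.2)).symm)
      (heq_map (R := R.Rel) (fun _ _ r => (extTheta O τ).1 _ _ r) (S.snd_pair _ _).symm
        (S.snd_pair _ _).symm (O.snd_pair ((R.ext σ).res r.1) ((R.ext τ).res r.2)).symm)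
  -- The two sides differ only by the casts in the product clause of `extRight`.
  pair_right _ _ := prod_mk_heq (castRel_heq _ _ _ _).symm (castRel_heq _ _ _ _).symm
  pair_left _ _ := prod_mk_heq (castRel_heq _ _ _ _).symm (castRel_heq _ _ _ _).symm
  app_tick {_ τ} f g x y p r :=
    heq_map (R := R.Rel) (fun _ _ r => (extTheta O τ).1 _ _ r) (f.2 x).symm (g.2 y).symm
      (p.2 x y r).symm
  app_right {_ τ} _ g x y p r :=
    castRel_heq (R.ext τ).rel rfl (congrArg (S.theta τ).1 (g.2 y))
      ((extRight O τ).1 _ _ (p.1.2 x y r))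
  app_left {_ τ} f _ x y p r :=
    castRel_heq (R.ext τ).rel (congrArg (S.theta τ).1 (f.2 x)) rfl
      ((extLeft O τ).1 _ _ (p.1.2 x y r))
  unfold_next _ := HEq.rfl
  next_unfold {τ} x y r := ((extTheta O τ.unfold).2 x y r).trans (O.unfold_next r).symm
  next_right {τ} x y r :=
    ((extRight O τ.unfold).2 x y r).trans (castRel_heq R.Rel rfl (S.unfold_next _).symm
      (O.right ((R.ext τ.unfold).res r))).symm
  next_left {τ} x y r :=
    ((extLeft O τ.unfold).2 x y r).trans (castRel_heq R.Rel (S.unfold_next _).symm rfl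
      (O.left ((R.ext τ.unfold).res r))).symm

end RelStage

/-- This is the guarded recursion: each stage supplies the hypothesis `▷` for the next. -/
def relOps : (n : ℕ) → (relStage n).Ops
  | 0 => RelStage.Ops.zero
  | n + 1 => (relOps n).succ

/-! ## The fundamental property -/

/-- `θ x ≈_σ θ y` at stage `n + 1` if `x ≈_σ y` at stage `n`. -/
def Rel.theta {n : ℕ} {σ : Ty 0} {x y : El n σ} (r : Rel x y) : Rel (FPC.theta x) (FPC.theta y) :=
  (RelStage.extTheta (relOps n) σ).1 x y r

theorem Rel.res_theta {n : ℕ} {σ : Ty 0} {x y : El n σ} (r : Rel x y) :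
    (Rel.theta r).res ≍ (relOps n).tick r :=
  (RelStage.extTheta (relOps n) σ).2 x y r

/-- `x ≈_σ δ^m y` if `x ≈_σ y`. -/
def Rel.iterRight {n : ℕ} {σ : Ty 0} {x y : El n σ} (r : Rel x y) :
    (m : ℕ) → Rel x (iter (stage n).delay m y)
  | 0 => r
  | m + 1 => (relOps n).right (r.iterRight m)

/-- `δ^m x ≈_σ y` if `x ≈_σ y`. -/
def Rel.iterLeft {n : ℕ} {σ : Ty 0} {x y : El n σ} (r : Rel x y) :
    (m : ℕ) → Rel (iter (stage n).delay m x) y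
  | 0 => r
  | m + 1 => (relOps n).left (r.iterLeft m)

theorem res_delay {n : ℕ} {σ : Ty 0} (x : El (n + 1) σ) :
    res ((stage (n + 1)).delay x) = (stage n).delay (res x) :=
  res_theta _

theorem res_iter_delay {n : ℕ} {σ : Ty 0} (x : El (n + 1) σ) (m : ℕ) :
    res (iter (stage (n + 1)).delay m x) = iter (stage n).delay m (res x) := by
  induction m with
  | zero => rfl
  | succ m ih => exact (res_delay _).trans (congrArg (stage n).delay ih)

theorem Rel.res_iterRight {n : ℕ} {σ : Ty 0} {x y : El (n + 1) σ} (r : Rel x y) (m : ℕ) :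
    (r.iterRight m).res ≍ r.res.iterRight m := by
  induction m with
  | zero => rfl
  | succ m ih =>
    exact ((RelStage.extRight (relOps n) σ).2 _ _ (r.iterRight m)).trans
      (heq_map (R := Rel) (fun _ _ r => (relOps n).right r) rfl (res_iter_delay y m) ih)

theorem Rel.res_iterLeft {n : ℕ} {σ : Ty 0} {x y : El (n + 1) σ} (r : Rel x y) (m : ℕ) :
    (r.iterLeft m).res ≍ r.res.iterLeft m := by
  induction m with
  | zero => rfl
  | succ m ih =>
    exact ((RelStage.extLeft (relOps n) σ).2 _ _ (r.iterLeft m)).trans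
      (heq_map (R := Rel) (fun _ _ r => (relOps n).left r) (res_iter_delay x m) rfl ih)

/-! ### Compatibility with the term formers other than `case` -/

namespace OpenRel

variable {Γ : Ctx} {σ τ υ : Ty 0}

def varMap (n : ℕ) : {Γ : Ctx} → {i : ℕ} → {σ : Ty 0} → (h : Lookup Γ i σ) → {γ γ' : Env n Γ} →
    EnvRel γ γ' → Rel (Hom.varMap n h γ) (Hom.varMap n h γ')
  | _, _, _, .zero, _, _, r => r.1
  | _, _, _, .succ h, _, _, r => varMap n h r.2

theorem varMap_nat (n : ℕ) : {Γ : Ctx} → {i : ℕ} → {σ : Ty 0} → (h : Lookup Γ i σ) →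
    {γ γ' : Env (n + 1) Γ} → (r : EnvRel γ γ') → (varMap (n + 1) h r).res ≍ varMap n h r.res
  | _, _, _, .zero, _, _, _ => HEq.rfl
  | _, _, _, .succ h, _, _, r => varMap_nat n h r.2

def var {i : ℕ} (h : Lookup Γ i σ) : OpenRel (.var h) (.var h) :=
  ⟨fun n => varMap n h, fun n => varMap_nat n h⟩

def star : OpenRel (Γ := Γ) .star .star :=
  ⟨fun n _ _ _ => (relStage n).oneRight 0 ⟨rfl⟩, fun _ _ _ _ => HEq.rfl⟩

def inl {f f' : Hom Γ σ} (p : OpenRel f f') : OpenRel (f.inl (τ := τ)) f'.inl :=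
  ⟨fun n _ _ r => (relStage n).sumRight 0 (p.map n r), fun n γ γ' r =>
    heq_map (R := Rel) (S := fun x y => Rel ((stage n).ret (.inl x)) ((stage n).ret (.inl y)))
      (fun x y r => (relStage n).sumRight (a := .inl x) (b := .inl y) 0 r)
      (f.nat n γ) (f'.nat n γ') (p.nat n r)⟩

def inr {f f' : Hom Γ τ} (p : OpenRel f f') : OpenRel (f.inr (σ := σ)) f'.inr :=
  ⟨fun n _ _ r => (relStage n).sumRight 0 (p.map n r), fun n γ γ' r =>
    heq_map (R := Rel) (S := fun x y => Rel ((stage n).ret (.inr x)) ((stage n).ret (.inr y)))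
      (fun x y r => (relStage n).sumRight (a := .inr x) (b := .inr y) 0 r)
      (f.nat n γ) (f'.nat n γ') (p.nat n r)⟩

def pair {f f' : Hom Γ σ} {g g' : Hom Γ τ} (p : OpenRel f f') (q : OpenRel g g') :
    OpenRel (f.pair g) (f'.pair g') :=
  ⟨fun n _ _ r => (relStage n).pair (p.map n r) (q.map n r), fun n γ γ' r =>
    (relStage n).pair_heq (f.nat n γ) (f'.nat n γ') (g.nat n γ) (g'.nat n γ') (p.nat n r)
      (q.nat n r)⟩

def fst {f f' : Hom Γ (.prod σ τ)} (p : OpenRel f f') : OpenRel f.fst f'.fst :=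
  ⟨fun n _ _ r => (relOps n).fst (p.map n r), fun n γ γ' r =>
    -- Restriction on a product is a `pair` of restrictions, from which the first component is
    -- recovered by `fst_pair`.
    ((relOps n).fst_pair _ _).symm.trans
      (heq_map (R := Rel) (fun _ _ r => (relOps n).fst r) (f.nat n γ) (f'.nat n γ') (p.nat n r))⟩

def snd {f f' : Hom Γ (.prod σ τ)} (p : OpenRel f f') : OpenRel f.snd f'.snd :=
  ⟨fun n _ _ r => (relOps n).snd (p.map n r), fun n γ γ' r =>
    ((relOps n).snd_pair _ _).symm.trans
      (heq_map (R := Rel) (fun _ _ r => (relOps n).snd r) (f.nat n γ) (f'.nat n γ') (p.nat n r))⟩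

def app {f f' : Hom Γ (.arrow σ τ)} {g g' : Hom Γ σ} (p : OpenRel f f') (q : OpenRel g g') :
    OpenRel (f.app g) (f'.app g') :=
  ⟨fun n _ _ r => (relStage n).app (p.map n r) (q.map n r), fun n γ γ' r =>
    ((p.map (n + 1) r).2 _ _ (q.map (n + 1) r)).trans
      (heq_map₂ (R := Rel) (S := Rel) (fun _ _ _ _ r s => (relStage n).app r s) (f.nat n γ)
        (f'.nat n γ') (g.nat n γ) (g'.nat n γ') (p.nat n r) (q.nat n r))⟩

/-- An element of the `Π`-type at stage `n + 1` contains one at stage `n`, so the abstraction is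
built by recursion on the stage. Its values are carried along because the compatibility condition at
stage `n + 1` refers to them. -/
def lamMap {f f' : Hom (σ :: Γ) τ} (p : OpenRel f f') : (n : ℕ) →
    {g : ∀ γ γ' : Env n Γ, EnvRel γ γ' → Rel ((Hom.lamMap f n).1 γ) ((Hom.lamMap f' n).1 γ') //
      ∀ γ γ' (r : EnvRel γ γ') (x x' : El n σ) (s : Rel x x'),
        (relStage n).app (g γ γ' r) s ≍ p.map n (γ := (x, γ)) (γ' := (x', γ')) (s, r)}
  | 0 => ⟨fun _ _ _ => ⟨⟩, fun _ _ _ _ _ _ => HEq.rfl⟩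
  | n + 1 =>
    ⟨fun γ γ' r => ⟨((lamMap p n).1 _ _ r.res, fun x x' s =>
        p.map (n + 1) (γ := (x, γ)) (γ' := (x', γ')) (s, r)), fun x x' s =>
        (p.nat n (γ := (x, γ)) (γ' := (x', γ')) (s, r)).trans
          ((lamMap p n).2 _ _ r.res _ _ (Rel.res s)).symm⟩, fun _ _ _ _ _ _ => HEq.rfl⟩

def lam {f f' : Hom (σ :: Γ) τ} (p : OpenRel f f') : OpenRel f.lam f'.lam :=
  ⟨fun n _ _ r => (lamMap p n).1 _ _ r, fun _ _ _ _ => HEq.rfl⟩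

def fold {τ : Ty 1} {f f' : Hom Γ τ.unfold} (p : OpenRel f f') : OpenRel f.fold f'.fold :=
  ⟨fun n _ _ r => (relStage n).next (p.map n r), fun n γ γ' r =>
    heq_map (R := Rel) (fun _ _ r => (relStage n).next r) (f.nat n γ) (f'.nat n γ') (p.nat n r)⟩

def unfold {τ : Ty 1} {f f' : Hom Γ (.mu τ)} (p : OpenRel f f') : OpenRel f.unfold f'.unfold :=
  ⟨fun n _ _ r => (relOps n).unfold (p.map n r), fun n γ γ' r =>
    -- Restricting after `θ` is `tick`, which is `unfold` after `next`, and `next` is the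
    -- restriction on the recursive type.
    ((RelStage.extTheta (relOps n) τ.unfold).2 _ _ (p.map (n + 1) r)).trans <|
      ((relOps n).unfold_next _).symm.trans <|
      heq_map (R := Rel) (fun _ _ r => (relOps n).unfold r) (f.nat n γ) (f'.nat n γ')
        (p.nat n r)⟩

end OpenRel

/-! ### Compatibility with `case` -/

/-- A homomorphism of `▷`-algebras commutes with `δ = θ ∘ next`; naturality moves the restriction
past it. -/
theorem Hom.copairMap_iter {Γ : Ctx} {σ τ υ : Ty 0} (f : Hom (σ :: Γ) υ) (g : Hom (τ :: Γ) υ)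
    (n : ℕ) (γ : Env (n + 1) Γ) (x : El (n + 1) (.sum σ τ)) (m : ℕ) :
    iter (stage (n + 1)).delay m (copairMap f g (n + 1) γ x) =
      copairMap f g (n + 1) γ (iter (stage (n + 1)).delay m x) := by
  induction m with
  | zero => rfl
  | succ m ih =>
    exact (congrArg (stage (n + 1)).delay ih).trans
      (congrArg theta (copairMap_nat f g n γ _))

namespace OpenRel

variable {Γ : Ctx} {σ τ υ : Ty 0} {f f' : Hom (σ :: Γ) υ} {g g' : Hom (τ :: Γ) υ}
  (p : OpenRel f f') (q : OpenRel g g')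

def copairMapNow (n : ℕ) {γ γ' : Env (n + 1) Γ} (ρ : EnvRel γ γ') :
    (a b : El (n + 1) σ ⊕ El (n + 1) τ) → SumRel Rel Rel a b →
    Rel (Hom.copairMap f g (n + 1) γ (.inl a)) (Hom.copairMap f' g' (n + 1) γ' (.inl b))
  | .inl a, .inl b, r => p.map (n + 1) (γ := (a, γ)) (γ' := (b, γ')) (r, ρ)
  | .inr a, .inr b, r => q.map (n + 1) (γ := (a, γ)) (γ' := (b, γ')) (r, ρ)

/-- The branches relate the undelayed results, and `iterRight` absorbs the `m` delays that the
homomorphism carries over to the result type. -/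
def copairMapRight (n : ℕ) {γ γ' : Env (n + 1) Γ} (ρ : EnvRel γ γ')
    (a : El (n + 1) σ ⊕ El (n + 1) τ) (y : El (n + 1) (.sum σ τ)) (m : ℕ)
    (b : El (n + 1) σ ⊕ El (n + 1) τ) (r : SumRel Rel Rel a b)
    (h : y = iter (stage (n + 1)).delay m ((stage (n + 1)).ret b)) :
    Rel (Hom.copairMap f g (n + 1) γ (.inl a)) (Hom.copairMap f' g' (n + 1) γ' y) :=
  castRel Rel rfl ((Hom.copairMap_iter f' g' n γ' ((stage (n + 1)).ret b) m).trans
    (congrArg (Hom.copairMap f' g' (n + 1) γ') h.symm)) ((copairMapNow p q n ρ a b r).iterRight m)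

theorem copairMapRight_heq (n : ℕ) {γ γ' : Env (n + 1) Γ} (ρ : EnvRel γ γ')
    (a : El (n + 1) σ ⊕ El (n + 1) τ) (y : El (n + 1) (.sum σ τ)) (m : ℕ)
    (b : El (n + 1) σ ⊕ El (n + 1) τ) (r : SumRel Rel Rel a b)
    (h : y = iter (stage (n + 1)).delay m ((stage (n + 1)).ret b)) :
    copairMapRight p q n ρ a y m b r h ≍ (copairMapNow p q n ρ a b r).iterRight m :=
  castRel_heq _ _ _ _

def copairMapLeft (n : ℕ) {γ γ' : Env (n + 1) Γ} (ρ : EnvRel γ γ')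
    (x : El (n + 1) (.sum σ τ)) (b : El (n + 1) σ ⊕ El (n + 1) τ) (m : ℕ)
    (a : El (n + 1) σ ⊕ El (n + 1) τ) (r : SumRel Rel Rel a b)
    (h : x = iter (stage (n + 1)).delay m ((stage (n + 1)).ret a)) :
    Rel (Hom.copairMap f g (n + 1) γ x) (Hom.copairMap f' g' (n + 1) γ' (.inl b)) :=
  castRel Rel ((Hom.copairMap_iter f g n γ ((stage (n + 1)).ret a) m).trans
    (congrArg (Hom.copairMap f g (n + 1) γ) h.symm)) rfl ((copairMapNow p q n ρ a b r).iterLeft m)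

theorem copairMapLeft_heq (n : ℕ) {γ γ' : Env (n + 1) Γ} (ρ : EnvRel γ γ')
    (x : El (n + 1) (.sum σ τ)) (b : El (n + 1) σ ⊕ El (n + 1) τ) (m : ℕ)
    (a : El (n + 1) σ ⊕ El (n + 1) τ) (r : SumRel Rel Rel a b)
    (h : x = iter (stage (n + 1)).delay m ((stage (n + 1)).ret a)) :
    copairMapLeft p q n ρ x b m a r h ≍ (copairMapNow p q n ρ a b r).iterLeft m :=
  castRel_heq _ _ _ _

/-- The four clauses follow those of `L R`; only the `θ`-`θ` clause calls the guarded hypothesis. -/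
def copairMap : (n : ℕ) → {γ γ' : Env n Γ} → EnvRel γ γ' →
    (x y : El n (.sum σ τ)) → Rel x y →
    Rel (Hom.copairMap f g n γ x) (Hom.copairMap f' g' n γ' y)
  | 0, _, _, _, _, _, _ => ⟨⟩
  | n + 1, _, _, ρ, .inl a, .inl b, r => copairMapNow p q n ρ a b r
  | n + 1, _, _, ρ, .inl a, .inr y, r => copairMapRight p q n ρ a (.inr y) r.1 r.2.1 r.2.2.1 r.2.2.2
  | n + 1, _, _, ρ, .inr x, .inl b, r => copairMapLeft p q n ρ (.inr x) b r.1 r.2.1 r.2.2.1 r.2.2.2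
  | n + 1, _, _, ρ, .inr x, .inr y, r => (copairMap n ρ.res x y r).theta

/-- This treats all `m` uniformly: `sumRight 0` falls under the `η`-`η` clause, a positive `m` under
the `η`-`θ` clause. Restricted proofs have the form `sumRight m`, so naturality of `copairMap` rests
on it. -/
theorem copairMap_right (n m : ℕ) {γ γ' : Env (n + 1) Γ} (ρ : EnvRel γ γ')
    {a b : El (n + 1) σ ⊕ El (n + 1) τ} (r : SumRel Rel Rel a b) :
    copairMap p q (n + 1) ρ _ _ ((relStage (n + 1)).sumRight m r) ≍
      (copairMapNow p q n ρ a b r).iterRight m := by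
  cases m with
  | zero => rfl
  | succ m => exact copairMapRight_heq p q n ρ a _ (m + 1) b r rfl

theorem copairMap_left (n m : ℕ) {γ γ' : Env (n + 1) Γ} (ρ : EnvRel γ γ')
    {a b : El (n + 1) σ ⊕ El (n + 1) τ} (r : SumRel Rel Rel a b) :
    copairMap p q (n + 1) ρ _ _ ((relStage (n + 1)).sumLeft m r) ≍
      (copairMapNow p q n ρ a b r).iterLeft m := by
  cases m with
  | zero => rfl
  | succ m => exact copairMapLeft_heq p q n ρ _ b (m + 1) a r rfl

theorem copairMapNow_nat (n : ℕ) {γ γ' : Env (n + 2) Γ} (ρ : EnvRel γ γ') :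
    (a b : El (n + 2) σ ⊕ El (n + 2) τ) → (r : SumRel Rel Rel a b) →
    (copairMapNow p q (n + 1) ρ a b r).res ≍
      copairMapNow p q n ρ.res _ _
        (SumRel.res ((relStage (n + 1)).ext σ) ((relStage (n + 1)).ext τ) a b r)
  | .inl a, .inl b, r => p.nat (n + 1) (γ := (a, γ)) (γ' := (b, γ')) (r, ρ)
  | .inr a, .inr b, r => q.nat (n + 1) (γ := (a, γ)) (γ' := (b, γ')) (r, ρ)

/-- The restricted proof is a cast of `sumRight m`; keeping it as a variable `s` known up to
heterogeneous equality frees the argument from the form of the cast. Restriction then passes through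
`iterRight` and through the branches, and `copairMap_right` recognises the outcome. -/
theorem copairMapRight_nat (n : ℕ) {γ γ' : Env (n + 2) Γ} (ρ : EnvRel γ γ')
    (a : El (n + 2) σ ⊕ El (n + 2) τ) (y : El (n + 2) (.sum σ τ)) (m : ℕ)
    (b : El (n + 2) σ ⊕ El (n + 2) τ) (r : SumRel Rel Rel a b)
    (h : y = iter (stage (n + 2)).delay m ((stage (n + 2)).ret b))
    (s : Rel (res ((stage (n + 2)).ret a)) (res y))
    (hs : s ≍ (relStage (n + 1)).sumRight m
      (SumRel.res ((relStage (n + 1)).ext σ) ((relStage (n + 1)).ext τ) a b r)) :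
    (copairMapRight p q (n + 1) ρ a y m b r h).res ≍ copairMap p q (n + 1) ρ.res _ _ s := by
  have e := (Hom.copairMap_iter f' g' (n + 1) γ' ((stage (n + 2)).ret b) m).trans
    (congrArg (Hom.copairMap f' g' (n + 2) γ') h.symm)
  have h₁ := map_castRel_heq (R := Rel) (S := fun x y => Rel (res x) (res y))
    (fun _ _ r => r.res) rfl e ((copairMapNow p q (n + 1) ρ a b r).iterRight m)
  have h₂ := Rel.res_iterRight (copairMapNow p q (n + 1) ρ a b r) m
  have h₃ := heq_map (R := Rel) (fun _ _ r => Rel.iterRight r m)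
    (Hom.copairMap_nat f g (n + 1) γ ((stage (n + 2)).ret a))
    (Hom.copairMap_nat f' g' (n + 1) γ' ((stage (n + 2)).ret b)) (copairMapNow_nat p q n ρ a b r)
  have h₄ := copairMap_right p q n m ρ.res
    (SumRel.res ((relStage (n + 1)).ext σ) ((relStage (n + 1)).ext τ) a b r)
  have h₅ := heq_map (R := Rel) (copairMap p q (n + 1) ρ.res) rfl
    ((congrArg res h).trans (res_iter_delay _ m)) hs
  exact h₁.trans (h₂.trans (h₃.trans (h₄.symm.trans h₅.symm)))

theorem copairMapLeft_nat (n : ℕ) {γ γ' : Env (n + 2) Γ} (ρ : EnvRel γ γ')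
    (x : El (n + 2) (.sum σ τ)) (b : El (n + 2) σ ⊕ El (n + 2) τ) (m : ℕ)
    (a : El (n + 2) σ ⊕ El (n + 2) τ) (r : SumRel Rel Rel a b)
    (h : x = iter (stage (n + 2)).delay m ((stage (n + 2)).ret a))
    (s : Rel (res x) (res ((stage (n + 2)).ret b)))
    (hs : s ≍ (relStage (n + 1)).sumLeft m
      (SumRel.res ((relStage (n + 1)).ext σ) ((relStage (n + 1)).ext τ) a b r)) :
    (copairMapLeft p q (n + 1) ρ x b m a r h).res ≍ copairMap p q (n + 1) ρ.res _ _ s := by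
  have e := (Hom.copairMap_iter f g (n + 1) γ ((stage (n + 2)).ret a) m).trans
    (congrArg (Hom.copairMap f g (n + 2) γ) h.symm)
  have h₁ := map_castRel_heq (R := Rel) (S := fun x y => Rel (res x) (res y))
    (fun _ _ r => r.res) e rfl ((copairMapNow p q (n + 1) ρ a b r).iterLeft m)
  have h₂ := Rel.res_iterLeft (copairMapNow p q (n + 1) ρ a b r) m
  have h₃ := heq_map (R := Rel) (fun _ _ r => Rel.iterLeft r m)
    (Hom.copairMap_nat f g (n + 1) γ ((stage (n + 2)).ret a))
    (Hom.copairMap_nat f' g' (n + 1) γ' ((stage (n + 2)).ret b)) (copairMapNow_nat p q n ρ a b r)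
  have h₄ := copairMap_left p q n m ρ.res
    (SumRel.res ((relStage (n + 1)).ext σ) ((relStage (n + 1)).ext τ) a b r)
  have h₅ := heq_map (R := Rel) (copairMap p q (n + 1) ρ.res)
    ((congrArg res h).trans (res_iter_delay _ m)) rfl hs
  exact h₁.trans (h₂.trans (h₃.trans (h₄.symm.trans h₅.symm)))

theorem copairMap_nat : (n : ℕ) → {γ γ' : Env (n + 1) Γ} → (ρ : EnvRel γ γ') →
    (x y : El (n + 1) (.sum σ τ)) → (r : Rel x y) →
    (copairMap p q (n + 1) ρ x y r).res ≍ copairMap p q n ρ.res (res x) (res y) r.res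
  | 0, _, _, _, _, _, _ => HEq.rfl
  | n + 1, _, _, ρ, .inl a, .inl b, r => copairMapNow_nat p q n ρ a b r
  | n + 1, _, _, ρ, .inl a, .inr y, r =>
    copairMapRight_nat p q n ρ a (.inr y) r.1 r.2.1 r.2.2.1 r.2.2.2 _ (cast_heq _ _)
  | n + 1, _, _, ρ, .inr x, .inl b, r =>
    copairMapLeft_nat p q n ρ (.inr x) b r.1 r.2.1 r.2.2.1 r.2.2.2 _ (cast_heq _ _)
  | n + 1, _, _, ρ, .inr x, .inr y, r =>
    (Rel.res_theta (copairMap p q (n + 1) ρ.res x y r)).trans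
      (heq_map (R := Rel) (fun _ _ r => Rel.theta r) (Hom.copairMap_nat f g n _ x)
        (Hom.copairMap_nat f' g' n _ y) (copairMap_nat n ρ.res x y r))

def case {l l' : Hom Γ (.sum σ τ)} (s : OpenRel l l') : OpenRel (l.case f g) (l'.case f' g') :=
  ⟨fun n _ _ r => copairMap p q n r _ _ (s.map n r), fun n γ γ' r =>
    (copairMap_nat p q n r _ _ (s.map (n + 1) r)).trans
      (heq_map (R := Rel) (copairMap p q n r.res) (l.nat n γ) (l'.nat n γ') (s.nat n r))⟩

end OpenRel

/-- Every definable map is related to itself. -/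
def Typing.denRel : {Γ : Ctx} → {M : Term} → {σ : Ty 0} → (d : Typing Γ M σ) → OpenRel d.den d.den
  | _, _, _, .var h => .var h
  | _, _, _, .star => .star
  | _, _, _, .lam d => .lam d.denRel
  | _, _, _, .app d e => .app d.denRel e.denRel
  | _, _, _, .inl d => .inl d.denRel
  | _, _, _, .inr d => .inr d.denRel
  | _, _, _, .case d e₁ e₂ => .case e₁.denRel e₂.denRel d.denRel
  | _, _, _, .fst d => .fst d.denRel
  | _, _, _, .snd d => .snd d.denRel
  | _, _, _, .pair d e => .pair d.denRel e.denRel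
  | _, _, _, .unfold d => .unfold d.denRel
  | _, _, _, .fold d => .fold d.denRel

/-! ## The counterexample to reflexivity -/

/-- The number of delays of `y` that a proof of `η a ≈_1 y` reveals, at stage `n + 1`. -/
def delays (n : ℕ) (a : Unit) : (y : El (n + 1) .one) → Rel ((stage (n + 1)).retOne a) y → ℕ
  | .inl _, _ => 0
  | .inr _, r => r.1

theorem eq_iter_delays (n : ℕ) (a : Unit) : (y : El (n + 1) .one) →
    (r : Rel ((stage (n + 1)).retOne a) y) →
    y = iter (stage (n + 1)).delay (delays n a y r) ((stage (n + 1)).retOne ())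
  | .inl _, _ => rfl
  | .inr _, r => r.2.2.2

theorem delays_heq (n : ℕ) (a : Unit) {y y' : El (n + 1) .one}
    {r : Rel ((stage (n + 1)).retOne a) y} {r' : Rel ((stage (n + 1)).retOne a) y'} (hy : y = y')
    (h : r ≍ r') : delays n a y r = delays n a y' r' := by
  subst hy h
  rfl

theorem delays_oneRight (n : ℕ) (a b : Unit) (r : UnitRel a b) (m : ℕ) :
    delays n a _ ((relStage (n + 1)).oneRight m r) = m := by
  cases m <;> rfl

/-- The number of delays comes from the constant presheaf `ℕ`: up to a cast, restriction turns a
proof with `m` delays into `oneRight m`. -/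
theorem delays_res (n : ℕ) (a : Unit) : (y : El (n + 2) .one) →
    (r : Rel ((stage (n + 2)).retOne a) y) →
    delays n a (res y) (Rel.res r) = delays (n + 1) a y r
  | .inl _, _ => rfl
  | .inr _, r =>
    (delays_heq n a (Ext.iter_eq_delay r.2.2.2).symm (cast_heq _ _)).trans
      (delays_oneRight n a _ r.2.2.1 r.1)

/-- Stripping a `θ` from both sides lowers `m` and the stage together, so `η *` is reached before
the stages run out. The bound matters: `⊥ = δ^(n + 1) (η *)` does hold at stage `n + 1`, so no
single stage refutes an unspecified number of delays. -/
theorem bot_ne_iter_delay : (m n : ℕ) → m ≤ n →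
    bot (n + 1) ≠ iter (stage (n + 1)).delay m ((stage (n + 1)).retOne ())
  | 0, _, _, h => nomatch h
  | m + 1, n + 1, hm, h =>
    bot_ne_iter_delay m n (Nat.le_of_succ_le_succ hm)
      ((Sum.inr.inj h).trans (res_iter_delay _ m))

theorem isNow_not_related : ¬ Nonempty (OpenRel isNow isNow) := by
  rintro ⟨p⟩
  -- One delay suffices: the function keeps `η *` but sends `δ (η *)` to `⊥`.
  let s (n : ℕ) : Rel ((stage n).retOne ()) ((stage n).delay ((stage n).retOne ())) :=
    (relStage n).oneRight 1 ⟨rfl⟩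
  let t (n : ℕ) : Rel ((stage (n + 1)).retOne ()) (bot (n + 1)) :=
    (relStage (n + 1)).app (p.map (n + 1) (γ := ()) (γ' := ()) ()) (s (n + 1))
  have ht (n : ℕ) : Rel.res (t (n + 1)) ≍ t n :=
    ((p.map (n + 2) (γ := ()) (γ' := ()) ()).2 ((stage (n + 2)).retOne ())
      ((stage (n + 2)).delay ((stage (n + 2)).retOne ())) (s (n + 2))).trans
      (heq_map (R := Rel)
        (S := fun f g => Rel ((stage (n + 1)).app f _) ((stage (n + 1)).app g _))
        (fun _ _ r => (relStage (n + 1)).app r (s (n + 1))) rfl rfl (p.nat (n + 1) ()))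
  -- Compatibility of the proofs `t n` forces a single number of delays at all stages; it is read
  -- off at stage 1.
  obtain ⟨m, hm⟩ : ∃ m, ∀ n, delays n () _ (t n) = m := by
    refine ⟨delays 0 () _ (t 0), fun n => ?_⟩
    induction n with
    | zero => rfl
    | succ n ih =>
      exact (delays_res n () _ (t (n + 1))).symm.trans
        ((delays_heq n () (delay_bot (n + 1)) (ht n)).trans ih)
  -- Stage `m + 1` is late enough for `m` delays to be told apart from divergence.
  have h := eq_iter_delays m () _ (t m)
  rw [hm] at h
  exact bot_ne_iter_delay m m le_rfl h

end FPC

theorem mainTheorem6 :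
    (∀ (Γ : FPC.Ctx) (M : FPC.Term) (σ : FPC.Ty 0) (d : FPC.Typing Γ M σ),
      Nonempty (FPC.OpenRel d.den d.den)) ∧
    ¬ Nonempty (FPC.OpenRel FPC.isNow FPC.isNow) :=
  ⟨fun _ _ _ d => ⟨d.denRel⟩, FPC.isNow_not_related⟩
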